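/- **Model.** $k$ players communicate over pairwise FIFO links with arbitrary finite delays. Player $i$ has an input $X_i$, a private random tape $R_i$, and access to a public random tape $R^p$; the tapes $R=(R_1,\dots,R_k)$ and $R^p$ are independent of each other and of the inputs, with arbitrary laws, and the players' actions depend measurably on them. The protocol of each player runs in local rounds $j=1,2,\dots$. In round $j$, as a function of its view (its input, its private tape, the public tape, and the messages it has read in earlier rounds), player $i$ sends self-delimiting binary messages to a subset of the other players, may write on its output tape (exactly once overall), and then waits for, and reads, one message from each player of some subset of the other players, whereupon the round ends. Every execution eventually has no message in transit. The protocol is *oblivious* if the sets of addressees and of awaited players depend only on $i$ and $j$. The transcript $\Pi_i$ of player $i$ is the concatenation of the messages it reads, ordered by local round and within each round by sender; $\Pi$ is the concatenation of $\Pi_1,\dots,\Pi_k$. A protocol computes a family $f=(f_i)_{1\le i\le k}$ of functions of $x=(x_1,\dots,x_k)$ with zero error if in every execution every player eventually writes an output and, for every $x$, with probability $1$ each player $i$ outputs $f_i(x)$. It is *private* for $f$ if for every player $i$, all inputs $x,x'$ with $x_i=x'_i$ and $f_i(x)=f_i(x')$, all values $r_i$ of $R_i$ and $r^p$ of $R^p$,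 and every string $T$, $$\Pr[\Pi_i=T\mid X=x,R_i=r_i,R^p=r^p]=\Pr[\Pi_i=T\mid X=x',R_i=r_i,R^p=r^p].$$ In the parity problem $\mathsf{Par}_k^n$ each player $i$ has an $n$-bit input $x_i=(x_i^1,\dots,x_i^n)$, and for each coordinate $p\in\{1,\dots,n\}$ a designated player $a(p)$ has to output $\bigoplus_{i=1}^k x_i^p$ (in the basic version, $a(p)=1$ for all $p$, so that player 1 outputs the whole bitwise XOR); a player without designated coordinates has a trivial output. **Theorem.** Let $a:\{1,\dots,n\}\to\{1,\dots,k\}$ be arbitrary. For every oblivious zero-error private protocol for $\mathsf{Par}_k^n$, the entropy that the private randomness contributes to the transcript satisfies $$H(\Pi\mid X R^p)\;\ge\;\frac{k-2}{k}\cdot n,$$ where $X$ is uniformly distributed on $(\{0,1\}^n)^k$ and $H$ is binary entropy (possibly $+\infty$). -/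

import Mathlib

open MeasureTheory
open scoped ENNReal

/-- The messages read by a player in one local round: `none` for the players that it did not
wait for, `some m` when the message `m` was read from the link with that player. -/
abbrev RoundReads (k : ℕ) : Type := Fin k → Option (List Bool)

/-- The view of a player: its input, its private randomness, the public randomness, and the
messages read in its completed local rounds (oldest round first). -/
structure View (k : ℕ) (X : Type*) (Ω : Type*) (Ωp : Type*) where
  input : X
  priv : Ω
  pub : Ωp
  received : List (RoundReads k)

/-- A `k`-player protocol. Player `i` has inputs in `X i`, outputs in `Y i` and private random
tapes in `Ω i`; public random tapes are in `Ωp`. In its local round `j ≥ 1`, as a function of its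
view at the end of round `j - 1`, player `i` sends the message `msg i j v q` to every player `q`
in `sendTo i j v`, writes `y` on its output tape if `out i j v = some y` (nothing if it is
`none`), and then waits for one message from every player in `waitFor i j v`. -/
structure Protocol (k : ℕ) (X Y Ω : Fin k → Type*) (Ωp : Type*) where
  sendTo : ∀ i, ℕ → View k (X i) (Ω i) Ωp → Finset (Fin k)
  msg : ∀ i, ℕ → View k (X i) (Ω i) Ωp → Fin k → List Bool
  out : ∀ i, ℕ → View k (X i) (Ω i) Ωp → Option (Y i)
  waitFor : ∀ i, ℕ → View k (X i) (Ω i) Ωp → Finset (Fin k)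
  self_notMem_sendTo : ∀ i j v, i ∉ sendTo i j v
  self_notMem_waitFor : ∀ i j v, i ∉ waitFor i j v

namespace Protocol

variable {k : ℕ} {X Y Ω : Fin k → Type*} {Ωp : Type*}

/-! ### Execution

In this model the sequence of views of each player does not depend on the delivery times, because
a player only acts on complete sets of awaited messages that it chose itself and links are FIFO.
The execution is therefore defined with unit delivery times. -/

/-- The view of player `i` when the messages read in its completed rounds are `h`. -/
def viewAt (x : ∀ i, X i) (r : ∀ i, Ω i) (rp : Ωp) (i : Fin k) (h : List (RoundReads k)) :
    View k (X i) (Ω i) Ωp :=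
  ⟨x i, r i, rp, h⟩

/-- The messages sent so far by player `i` to player `q`, in order, when player `i` has completed
rounds with reads `h`, so that it has started the rounds `1, …, h.length + 1`. -/
def sentGiven (π : Protocol k X Y Ω Ωp) (x : ∀ i, X i) (r : ∀ i, Ω i) (rp : Ωp)
    (i : Fin k) (h : List (RoundReads k)) (q : Fin k) : List (List Bool) :=
  (List.range (h.length + 1)).filterMap fun t =>
    if q ∈ π.sendTo i (t + 1) (viewAt x r rp i (h.take t)) then
      some (π.msg i (t + 1) (viewAt x r rp i (h.take t)) q)
    else none

/-- The number of messages from player `q` among the reads `h`. -/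
def numRead (h : List (RoundReads k)) (q : Fin k) : ℕ :=
  (h.filterMap fun reads => reads q).length

/-- The messages read by every player in its completed local rounds, at global time `T`. At each
time step, a player whose awaited messages have all been sent reads the next unread message on
each awaited link, which completes its current round; any other player keeps waiting. -/
def history (π : Protocol k X Y Ω Ωp) (x : ∀ i, X i) (r : ∀ i, Ω i) (rp : Ωp) :
    ℕ → Fin k → List (RoundReads k)
  | 0 => fun _ => []
  | T + 1 => fun i =>
      let h := history π x r rp T
      let W := π.waitFor i ((h i).length + 1) (viewAt x r rp i (h i))
      if ∀ q ∈ W, numRead (h i) q < (π.sentGiven x r rp q (h q) i).length then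
        h i ++ [fun q => if q ∈ W then (π.sentGiven x r rp q (h q) i)[numRead (h i) q]? else none]
      else h i

/-- The messages sent by player `i` to player `q` up to global time `T`, in order. -/
def sent (π : Protocol k X Y Ω Ωp) (x : ∀ i, X i) (r : ∀ i, Ω i) (rp : Ωp)
    (T : ℕ) (i q : Fin k) : List (List Bool) :=
  π.sentGiven x r rp i (π.history x r rp T i) q

/-- The concatenation of the messages read by player `i` up to global time `T`, ordered by local
round, and within a round by the index of the sender. -/
def transcriptAt (π : Protocol k X Y Ω Ωp) (x : ∀ i, X i) (r : ∀ i, Ω i) (rp : Ωp)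
    (i : Fin k) (T : ℕ) : List Bool :=
  (π.history x r rp T i).flatMap fun reads =>
    (List.finRange k).flatMap fun q => (reads q).getD []

open Classical in
/-- The transcript `Π_i` of player `i`: the final value of `transcriptAt` (which exists when the
protocol stops; the empty string otherwise). -/
noncomputable def playerTranscript (π : Protocol k X Y Ω Ωp) (x : ∀ i, X i) (r : ∀ i, Ω i)
    (rp : Ωp) (i : Fin k) : List Bool :=
  if h : ∃ s, ∀ᶠ T in Filter.atTop, π.transcriptAt x r rp i T = s then h.choose else []

/-- The transcript `Π` of the protocol: the concatenation of the `Π_i`, ordered by player. -/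
noncomputable def transcript (π : Protocol k X Y Ω Ωp) (x : ∀ i, X i) (r : ∀ i, Ω i)
    (rp : Ωp) : List Bool :=
  (List.finRange k).flatMap fun i => π.playerTranscript x r rp i

/-- In the given execution, player `i` writes `y` on its output tape in its local round `j + 1`. -/
def Writes (π : Protocol k X Y Ω Ωp) (x : ∀ i, X i) (r : ∀ i, Ω i) (rp : Ωp)
    (i : Fin k) (j : ℕ) (y : Y i) : Prop :=
  ∃ T, j ≤ (π.history x r rp T i).length ∧
    π.out i (j + 1) (viewAt x r rp i ((π.history x r rp T i).take j)) = some y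

/-! ### Standing requirements on protocols -/

/-- Messages are self-delimiting: on every link and for every `l`, the possible values of the
`l`-th message on that link form a prefix-free set. -/
def SelfDelimiting (π : Protocol k X Y Ω Ωp) : Prop :=
  ∀ (i q : Fin k) (l : ℕ) (x x' : ∀ i, X i) (r r' : ∀ i, Ω i) (rp rp' : Ωp) (T T' : ℕ)
    (m m' : List Bool),
    (π.sent x r rp T i q)[l]? = some m → (π.sent x' r' rp' T' i q)[l]? = some m' →
      m <+: m' → m = m'

/-- No player writes more than once on its output tape. -/
def WritesAtMostOnce (π : Protocol k X Y Ω Ωp) : Prop :=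
  ∀ (x : ∀ i, X i) (r : ∀ i, Ω i) (rp : Ωp) (i : Fin k) (j j' : ℕ) (y y' : Y i),
    π.Writes x r rp i j y → π.Writes x r rp i j' y' → j = j'

/-- The protocol stops in every execution: after some time no further message is sent, so that
eventually no message is in transit. -/
def Stops (π : Protocol k X Y Ω Ωp) : Prop :=
  ∀ (x : ∀ i, X i) (r : ∀ i, Ω i) (rp : Ωp), ∃ T, ∀ T' ≥ T, ∀ i q,
    π.sent x r rp T' i q = π.sent x r rp T i q

/-- The actions of the players are measurable functions of the randomness. -/
def MeasurableActions [∀ i, MeasurableSpace (Ω i)] [MeasurableSpace Ωp]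
    (π : Protocol k X Y Ω Ωp) : Prop :=
  ∀ (i : Fin k) (j : ℕ) (a : X i) (h : List (RoundReads k)),
    (∀ s, MeasurableSet {ω : Ω i × Ωp | π.sendTo i j ⟨a, ω.1, ω.2, h⟩ = s}) ∧
    (∀ q m, MeasurableSet {ω : Ω i × Ωp | π.msg i j ⟨a, ω.1, ω.2, h⟩ q = m}) ∧
    (∀ o, MeasurableSet {ω : Ω i × Ωp | π.out i j ⟨a, ω.1, ω.2, h⟩ = o}) ∧
    (∀ s, MeasurableSet {ω : Ω i × Ωp | π.waitFor i j ⟨a, ω.1, ω.2, h⟩ = s})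

/-- A protocol: all the standing requirements of the communication model. -/
structure WellFormed [∀ i, MeasurableSpace (Ω i)] [MeasurableSpace Ωp]
    (π : Protocol k X Y Ω Ωp) : Prop where
  selfDelimiting : π.SelfDelimiting
  writesAtMostOnce : π.WritesAtMostOnce
  stops : π.Stops
  measurableActions : π.MeasurableActions

/-! ### Oblivious protocols, computing a family of functions, privacy, entropy -/

/-- Oblivious: the communication pattern depends only on the player and on the local round. -/
def Oblivious (π : Protocol k X Y Ω Ωp) : Prop :=
  ∀ (i : Fin k) (j : ℕ) (v v' : View k (X i) (Ω i) Ωp),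
    π.sendTo i j v = π.sendTo i j v' ∧ π.waitFor i j v = π.waitFor i j v'

/-- `π` computes the family `f` with error at most `ε`, when the private and public random tapes
are independent with laws `P i` and `Pp`: in every execution every player eventually writes an
output, and on every input the probability that some output is wrong is at most `ε`. -/
def Computes [∀ i, MeasurableSpace (Ω i)] [MeasurableSpace Ωp]
    (π : Protocol k X Y Ω Ωp) (P : ∀ i, Measure (Ω i)) (Pp : Measure Ωp)
    (f : ∀ i, (∀ l, X l) → Y i) (ε : ℝ≥0∞) : Prop :=
  (∀ (x : ∀ i, X i) (r : ∀ i, Ω i) (rp : Ωp) (i : Fin k), ∃ j y, π.Writes x r rp i j y) ∧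
  ∀ x : ∀ i, X i, ((Measure.pi P).prod Pp)
    {ω | ¬ ∀ i, ∃ j, π.Writes x ω.1 ω.2 i j (f i x)} ≤ ε

/-- `π` is (1-)private for the family `f`: for every player `i`, the law of `Π_i` given
`R_i = ρ` and `R^p = rp` is the same for any two inputs with the same `i`-th input and the same
value of `f i`. The probability is over the private tapes of the other players (the `i`-th tape
drawn from `Measure.pi P` is overwritten by `ρ`). -/
def IsPrivate [∀ i, MeasurableSpace (Ω i)]
    (π : Protocol k X Y Ω Ωp) (P : ∀ i, Measure (Ω i))
    (f : ∀ i, (∀ l, X l) → Y i) : Prop :=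
  ∀ (i : Fin k) (x x' : ∀ l, X l), f i x = f i x' → x i = x' i →
    ∀ (ρ : Ω i) (rp : Ωp) (s : List Bool),
      Measure.pi P {r | π.playerTranscript x (Function.update r i ρ) rp i = s} =
      Measure.pi P {r | π.playerTranscript x' (Function.update r i ρ) rp i = s}

end Protocol

/-- The binary entropy `∑ p log₂ (1/p)` of a discrete random variable `Z`, possibly infinite. -/
noncomputable def entropy {Ω α : Type*} [MeasurableSpace Ω] (P : Measure Ω) (Z : Ω → α) : ℝ≥0∞ :=
  ∑' a, ENNReal.ofReal (Real.negMulLog (P.real (Z ⁻¹' {a})) / Real.log 2)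

/-- The conditional entropy `H_μ(Π | X R^p)`: the mean over `x ∼ μ` and `rp ∼ Pp` of the entropy
of `Π` given `X = x` and `R^p = rp`, where the input, the private tapes and the public tape are
independent. -/
noncomputable def Protocol.transcriptEntropy {k : ℕ} {X Y Ω : Fin k → Type*} {Ωp : Type*}
    [∀ i, MeasurableSpace (Ω i)] [MeasurableSpace Ωp]
    (π : Protocol k X Y Ω Ωp) (P : ∀ i, Measure (Ω i)) (Pp : Measure Ωp)
    (μ : PMF (∀ i, X i)) : ℝ≥0∞ :=
  ∑' x, μ x * ∫⁻ rp, entropy (Measure.pi P) (fun r => π.transcript x r rp) ∂Pp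

/-- The `k`-party parity problem on `n`-bit inputs: for every coordinate `p`, player `a p` has to
output the XOR of the `p`-th bits of all the inputs; the player's output is the family of these
bits over its coordinates (trivial for a player without coordinates). If player 1 has to output
the whole bitwise XOR, then `a` is constant. -/
def parity {k n : ℕ} (a : Fin n → Fin k) (i : Fin k) (x : Fin k → Fin n → Bool) :
    {p : Fin n // a p = i} → Bool :=
  fun p => ((List.finRange k).map fun l => x l p).foldr xor false

/-! Fix the public tape and all private tapes. Every message is then a function of the uniform input
x, and player i learns I(X; Π_i | X_i) bits from what it reads. The proof bounds the sum of these
quantities over i from both sides. Let n_j be the number of coordinates p with a(p) = j, so that the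
n_j add up to n.

Lower bound (k-1)n. Given all inputs except x_j, the messages sent by j determine everything the
other players read, hence their outputs, hence the n - n_j bits of x_j that are not designated to j.
So the messages sent by j have entropy at least n - n_j given the other inputs. Each message is at
least as informative to its receiver as this count credits to its sender j: the other inputs
together with the earlier messages of j determine the receiver's past view, and finer conditioning
lowers entropy (`logClassSum_submodular`, `sum_logClassSum_sent_le_received`). For fixed tapes,
entropies are averages of logarithms of class sizes of partitions of the input set.

Upper bound k·H + n (`lintegral_conditionalBits_le`). Now average over the private tapes. By
concavity, no longer fixing the tapes of the others only raises the entropy, to at most H(Π_i | X_i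
R_i). By privacy the law of Π_i given X_i and R_i depends on x only through the output of i, so it
is a uniform mixture of 2^(n_i) laws, and H(Π_i | X_i R_i) ≤ H(Π_i | X R_i) + n_i ≤ H(Π_i | X) + n_i
≤ H(Π | X) + n_i. Summing over i gives (k-1)n ≤ k·H + n.

Obliviousness makes the schedule the same in all executions. A transcript, as a bit string, is
therefore equivalent to the family of messages indexed by time, receiver and sender. -/

/-! ### Unique decoding of concatenated prefix-free messages -/

section UniqueDecoding

/-- Two equal strings both start with the content of the first filled slot, so one content is a
prefix of the other and `hpre` makes them equal; cancel and continue. That the same slots are filled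
on both sides excludes an empty slot facing a message. -/
lemma List.flatMap_getD_inj {ι α : Type*} (L : List ι) (F G : ι → Option (List α))
    (hsome : ∀ e ∈ L, (F e).isSome = (G e).isSome)
    (hpre : ∀ e ∈ L, ∀ m m', F e = some m → G e = some m' → m <+: m' ∨ m' <+: m → m = m')
    (h : L.flatMap (fun e => (F e).getD []) = L.flatMap fun e => (G e).getD []) :
    ∀ e ∈ L, F e = G e := by
  induction L with
  | nil => simp
  | cons e L ih =>
    simp only [List.flatMap_cons] at h
    have he : F e = G e := by
      have h1 := hsome e (by simp)
      have h2 := hpre e (by simp)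
      cases hF : F e with
      | none => rw [hF] at h1; symm; simpa using h1
      | some m =>
        cases hG : G e with
        | none => rw [hF, hG] at h1; simp at h1
        | some m' =>
          rw [hF, hG] at h
          simp only [Option.getD_some] at h
          rw [h2 m m' hF hG (List.prefix_or_prefix_of_prefix ⟨_, rfl⟩ ⟨_, h.symm⟩)]
    rw [he] at h
    have := ih (fun e he => hsome e (by simp [he])) (fun e he => hpre e (by simp [he]))
      (List.append_cancel_left h)
    intro e' he'
    rcases List.mem_cons.1 he' with rfl | h'
    · exact he
    · exact this e' h'

end UniqueDecoding

/-! ### Executions as sequences of reads in global time -/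

namespace Protocol

variable {k : ℕ} {X Y Ω : Fin k → Type*} {Ωp : Type*}
variable (π : Protocol k X Y Ω Ωp) (x : ∀ i, X i) (r : ∀ i, Ω i) (rp : Ωp)

/-- At time `T`, player `i` can complete its current local round. -/
def CanRead (T : ℕ) (i : Fin k) : Prop :=
  ∀ q ∈ π.waitFor i ((π.history x r rp T i).length + 1) (viewAt x r rp i (π.history x r rp T i)),
    numRead (π.history x r rp T i) q < (π.sent x r rp T q i).length

open Classical in
/-- The message read by player `i` from player `q` at time step `T`, if any. -/
noncomputable def readAt (T : ℕ) (i q : Fin k) : Option (List Bool) :=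
  if π.CanRead x r rp T i ∧ q ∈ π.waitFor i ((π.history x r rp T i).length + 1)
      (viewAt x r rp i (π.history x r rp T i)) then
    (π.sent x r rp T q i)[numRead (π.history x r rp T i) q]?
  else none

open Classical in
lemma history_succ (T : ℕ) (i : Fin k) :
    π.history x r rp (T + 1) i = π.history x r rp T i ++
      if π.CanRead x r rp T i then [fun q => π.readAt x r rp T i q] else [] := by
  by_cases h : π.CanRead x r rp T i
  · have h' := h
    simp only [CanRead, sent] at h'
    simp only [history, readAt, h, true_and, if_true, sent]
    rw [if_pos h']
  · have h' := h
    simp only [CanRead, sent] at h'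
    simp only [history, h, if_false, List.append_nil]
    rw [if_neg h']

lemma history_prefix {T T' : ℕ} (h : T ≤ T') (i : Fin k) :
    π.history x r rp T i <+: π.history x r rp T' i := by
  induction T', h using Nat.le_induction with
  | base => exact List.prefix_rfl
  | succ n _ ih =>
    rw [history_succ]
    exact ih.trans (List.prefix_append _ _)

lemma numRead_append (h h' : List (RoundReads k)) (q : Fin k) :
    numRead (h ++ h') q = numRead h q + numRead h' q := by
  simp [numRead, List.filterMap_append]

lemma transcriptAt_succ (T : ℕ) (i : Fin k) :
    π.transcriptAt x r rp i (T + 1) = π.transcriptAt x r rp i T ++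
      (List.finRange k).flatMap fun q => (π.readAt x r rp T i q).getD [] := by
  unfold transcriptAt
  rw [history_succ]
  by_cases h : π.CanRead x r rp T i
  · simp [h, List.flatMap_append]
  · simp [h, readAt]

lemma transcriptAt_eq_flatMap (T : ℕ) (i : Fin k) :
    π.transcriptAt x r rp i T = (List.range T).flatMap fun t =>
      (List.finRange k).flatMap fun q => (π.readAt x r rp t i q).getD [] := by
  induction T with
  | zero => simp [transcriptAt, history]
  | succ T ih =>
    rw [transcriptAt_succ, ih, List.range_succ, List.flatMap_append]
    simp

/-! ### The communication pattern of an oblivious protocol -/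

/-- The pattern of the reads of a player, without the contents of the messages. -/
def readPattern (h : List (RoundReads k)) : List (Fin k → Bool) :=
  h.map fun reads q => (reads q).isSome

lemma numRead_eq_of_readPattern {h h' : List (RoundReads k)} (e : readPattern h = readPattern h')
    (q : Fin k) : numRead h q = numRead h' q := by
  have key : ∀ h : List (RoundReads k), numRead h q = (readPattern h).countP (fun b => b q) := by
    intro h
    induction h with
    | nil => rfl
    | cons a h ih =>
      rw [show a :: h = [a] ++ h from rfl, numRead_append, ih, readPattern, readPattern,
        List.map_append, List.countP_append]
      congr 1
      cases ha : a q <;> simp [numRead, ha]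
  rw [key, key, e]

variable {π}

/-- The view `v₀` is a dummy: addressees do not depend on it, so the count depends on `h` only
through the number of completed rounds. -/
lemma length_sentGiven (hobl : π.Oblivious) (i q : Fin k) (h : List (RoundReads k))
    (v₀ : View k (X i) (Ω i) Ωp) :
    (π.sentGiven x r rp i h q).length =
      (List.range (h.length + 1)).countP fun t => decide (q ∈ π.sendTo i (t + 1) v₀) := by
  unfold sentGiven
  have : ∀ t, π.sendTo i (t + 1) (viewAt x r rp i (h.take t)) = π.sendTo i (t + 1) v₀ :=
    fun t => (hobl i (t + 1) _ _).1
  simp_rw [this]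
  generalize List.range (h.length + 1) = l
  induction l with
  | nil => rfl
  | cons a l ih =>
    by_cases ha : q ∈ π.sendTo i (a + 1) v₀
    · rw [List.filterMap_cons_some (by rw [if_pos ha]), List.countP_cons_of_pos (by simpa using ha)]
      simp [ih]
    · rw [List.filterMap_cons_none (by rw [if_neg ha]), List.countP_cons_of_neg (by simpa using ha)]
      exact ih

/-- Whether a round can end is decided by the awaited set and by the numbers of messages sent and
read. Under obliviousness all of these are functions of the read patterns so far, so the pattern
evolves identically in all executions, even for different public tapes. -/
lemma readPattern_history_eq (hobl : π.Oblivious) (x x' : ∀ i, X i) (r r' : ∀ i, Ω i)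
    (rp rp' : Ωp) (T : ℕ) :
    ∀ i, readPattern (π.history x r rp T i) = readPattern (π.history x' r' rp' T i) := by
  induction T with
  | zero => intro i; rfl
  | succ T ih =>
    have hlen : ∀ i, (π.history x r rp T i).length = (π.history x' r' rp' T i).length := by
      intro i
      simpa [readPattern] using congrArg List.length (ih i)
    have hsent : ∀ i q, (π.sent x r rp T i q).length = (π.sent x' r' rp' T i q).length := by
      intro i q
      unfold sent
      rw [length_sentGiven x r rp hobl i q _ (viewAt x r rp i []),
        length_sentGiven x' r' rp' hobl i q _ (viewAt x r rp i []), hlen]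
    intro i
    have hW : π.waitFor i ((π.history x r rp T i).length + 1)
          (viewAt x r rp i (π.history x r rp T i)) =
        π.waitFor i ((π.history x' r' rp' T i).length + 1)
          (viewAt x' r' rp' i (π.history x' r' rp' T i)) := by
      rw [hlen]; exact (hobl _ _ _ _).2
    have hnum : ∀ q, numRead (π.history x r rp T i) q = numRead (π.history x' r' rp' T i) q :=
      numRead_eq_of_readPattern (ih i)
    have hcan : π.CanRead x r rp T i ↔ π.CanRead x' r' rp' T i := by
      unfold CanRead
      rw [hW]
      simp_rw [hnum, hsent]
    rw [history_succ, history_succ]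
    simp only [readPattern, List.map_append] at ih ⊢
    rw [ih i]
    congr 1
    by_cases h : π.CanRead x r rp T i
    · have h' := hcan.1 h
      rw [if_pos h, if_pos h']
      simp only [List.map_cons, List.map_nil, List.cons.injEq, and_true]
      ext q
      unfold readAt
      rw [hW]
      by_cases hq : q ∈ π.waitFor i ((π.history x' r' rp' T i).length + 1)
          (viewAt x' r' rp' i (π.history x' r' rp' T i))
      · rw [if_pos ⟨h, hq⟩, if_pos ⟨h', hq⟩]
        have a1 := h q (hW ▸ hq)
        have a2 := h' q hq
        rw [List.getElem?_eq_getElem a1, List.getElem?_eq_getElem a2]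
        rfl
      · simp [hq]
    · rw [if_neg h, if_neg fun h' => h (hcan.2 h')]

lemma length_history_eq (hobl : π.Oblivious) (x x' : ∀ i, X i) (r r' : ∀ i, Ω i)
    (rp rp' : Ωp) (T : ℕ) (i : Fin k) :
    (π.history x r rp T i).length = (π.history x' r' rp' T i).length := by
  simpa [readPattern] using
    congrArg List.length (readPattern_history_eq hobl x x' r r' rp rp' T i)

lemma numRead_history_eq (hobl : π.Oblivious) (x x' : ∀ i, X i) (r r' : ∀ i, Ω i)
    (rp rp' : Ωp) (T : ℕ) (i q : Fin k) :
    numRead (π.history x r rp T i) q = numRead (π.history x' r' rp' T i) q :=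
  numRead_eq_of_readPattern (readPattern_history_eq hobl x x' r r' rp rp' T i) q

lemma length_sent_eq (hobl : π.Oblivious) (x x' : ∀ i, X i) (r r' : ∀ i, Ω i)
    (rp rp' : Ωp) (T : ℕ) (i q : Fin k) :
    (π.sent x r rp T i q).length = (π.sent x' r' rp' T i q).length := by
  unfold sent
  rw [length_sentGiven x r rp hobl i q _ (viewAt x r rp i []),
    length_sentGiven x' r' rp' hobl i q _ (viewAt x r rp i []),
    length_history_eq hobl x x' r r' rp rp' T i]

lemma waitFor_history_eq (hobl : π.Oblivious) (x x' : ∀ i, X i) (r r' : ∀ i, Ω i)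
    (rp rp' : Ωp) (T : ℕ) (i : Fin k) : π.waitFor i ((π.history x r rp T i).length + 1)
      (viewAt x r rp i (π.history x r rp T i)) =
    π.waitFor i ((π.history x' r' rp' T i).length + 1)
      (viewAt x' r' rp' i (π.history x' r' rp' T i)) := by
  rw [length_history_eq hobl x x' r r' rp rp' T i]
  exact (hobl _ _ _ _).2

lemma canRead_iff (hobl : π.Oblivious) (x x' : ∀ i, X i) (r r' : ∀ i, Ω i)
    (rp rp' : Ωp) (T : ℕ) (i : Fin k) : π.CanRead x r rp T i ↔ π.CanRead x' r' rp' T i := by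
  unfold CanRead
  rw [waitFor_history_eq hobl x x' r r' rp rp' T i]
  simp_rw [numRead_history_eq hobl x x' r r' rp rp' T i, length_sent_eq hobl x x' r r' rp rp' T]

end Protocol

/-! ### Messages, histories and decoding in oblivious protocols -/

namespace Protocol

variable {k : ℕ} {X Y Ω : Fin k → Type*} {Ωp : Type*} {π : Protocol k X Y Ω Ωp}

lemma isSome_readAt_eq (hobl : π.Oblivious) (x x' : ∀ i, X i) (r r' : ∀ i, Ω i)
    (rp rp' : Ωp) (T : ℕ) (i q : Fin k) :
    (π.readAt x r rp T i q).isSome = (π.readAt x' r' rp' T i q).isSome := by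
  unfold readAt
  have hW := waitFor_history_eq hobl x x' r r' rp rp' T i
  rw [hW]
  by_cases h : π.CanRead x r rp T i
  · have h' := (canRead_iff hobl x x' r r' rp rp' T i).1 h
    by_cases hq : q ∈ π.waitFor i ((π.history x' r' rp' T i).length + 1)
          (viewAt x' r' rp' i (π.history x' r' rp' T i))
    · rw [if_pos ⟨h, hq⟩, if_pos ⟨h', hq⟩]
      have a1 := h q (hW ▸ hq)
      have a2 := h' q hq
      rw [List.getElem?_eq_getElem a1, List.getElem?_eq_getElem a2]
      rfl
    · simp [hq]
  · have h' := fun h' => h ((canRead_iff hobl x x' r r' rp rp' T i).2 h')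
    rw [if_neg fun a => h a.1, if_neg fun a => h' a.1]

lemma readAt_self (x : ∀ i, X i) (r : ∀ i, Ω i) (rp : Ωp) (T : ℕ) (i : Fin k) :
    π.readAt x r rp T i i = none := by
  unfold readAt
  exact if_neg fun h => π.self_notMem_waitFor _ _ _ h.2

lemma getElem?_sent_of_readAt {x : ∀ i, X i} {r : ∀ i, Ω i} {rp : Ωp} {T : ℕ} {i q : Fin k}
    {m : List Bool} (h : π.readAt x r rp T i q = some m) :
    (π.sent x r rp T q i)[numRead (π.history x r rp T i) q]? = some m := by
  unfold readAt at h
  split_ifs at h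
  exact h

/-- The message read at a given time step is a function of the view of its sender. -/
lemma readAt_congr (hobl : π.Oblivious) {x x' : ∀ i, X i} {r r' : ∀ i, Ω i} {rp : Ωp} {T : ℕ}
    {q : Fin k} (hx : x q = x' q) (hr : r q = r' q)
    (hh : π.history x r rp T q = π.history x' r' rp T q) (i : Fin k) :
    π.readAt x r rp T i q = π.readAt x' r' rp T i q := by
  unfold readAt
  have h1 : π.sent x r rp T q i = π.sent x' r' rp T q i := by
    have hv : ∀ h, viewAt x r rp q h = viewAt x' r' rp q h := fun h => by
      simp only [viewAt, hx, hr]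
    unfold sent sentGiven
    rw [hh]
    refine congrArg₂ _ (funext fun t => ?_) rfl
    rw [hv]
  rw [waitFor_history_eq hobl x x' r r' rp rp T i, h1,
    numRead_history_eq hobl x x' r r' rp rp T i q]
  rw [propext (canRead_iff hobl x x' r r' rp rp T i)]

/-- Round boundaries come from the common schedule, so only the contents of the reads can make two
histories differ. -/
lemma history_congr (hobl : π.Oblivious) {x x' : ∀ i, X i} {r r' : ∀ i, Ω i} {rp rp' : Ωp} {T : ℕ}
    {i : Fin k} (h : ∀ t < T, ∀ q, π.readAt x r rp t i q = π.readAt x' r' rp' t i q) :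
    π.history x r rp T i = π.history x' r' rp' T i := by
  induction T with
  | zero => rfl
  | succ T ih =>
    rw [history_succ, history_succ, ih fun t ht => h t (ht.trans (Nat.lt_succ_self T)),
      funext (h T (Nat.lt_succ_self T))]
    rw [propext (canRead_iff hobl x x' r r' rp rp' T i)]

/-- Messages read at the same time on the same link have the same index on that link in both
executions, which is where prefix-freeness is assumed. -/
lemma readAt_eq_of_prefix (hobl : π.Oblivious) (hsd : π.SelfDelimiting) {x x' : ∀ i, X i}
    {r r' : ∀ i, Ω i} {rp rp' : Ωp} {T : ℕ} {i q : Fin k} {m m' : List Bool}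
    (h : π.readAt x r rp T i q = some m) (h' : π.readAt x' r' rp' T i q = some m')
    (hm : m <+: m' ∨ m' <+: m) : m = m' := by
  have a := getElem?_sent_of_readAt h
  have a' := getElem?_sent_of_readAt h'
  rw [numRead_history_eq hobl x' x r' r rp' rp T i q] at a'
  rcases hm with hm | hm
  · exact hsd _ _ _ _ _ _ _ _ _ _ _ _ _ a a' hm
  · exact (hsd _ _ _ _ _ _ _ _ _ _ _ _ _ a' a hm).symm

/-! ### Stabilisation -/

lemma numRead_history_succ (x : ∀ i, X i) (r : ∀ i, Ω i) (rp : Ωp) (T : ℕ) (i q : Fin k) :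
    numRead (π.history x r rp (T + 1) i) q = numRead (π.history x r rp T i) q +
      if (π.readAt x r rp T i q).isSome then 1 else 0 := by
  rw [history_succ, numRead_append]
  congr 1
  by_cases h : π.CanRead x r rp T i
  · rw [if_pos h]
    cases hq : π.readAt x r rp T i q <;> simp [numRead, hq]
  · simp [h, readAt, numRead]

lemma numRead_le_length_sent (hobl : π.Oblivious) (x : ∀ i, X i) (r : ∀ i, Ω i) (rp : Ωp) (T : ℕ)
    (i q : Fin k) : numRead (π.history x r rp T i) q ≤ (π.sent x r rp T q i).length := by
  induction T with
  | zero => simp [history, numRead]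
  | succ T ih =>
    have hmono : (π.sent x r rp T q i).length ≤ (π.sent x r rp (T + 1) q i).length := by
      unfold sent
      rw [length_sentGiven x r rp hobl q i _ (viewAt x r rp q []),
        length_sentGiven x r rp hobl q i _ (viewAt x r rp q [])]
      refine List.Sublist.countP_le (List.range_sublist.2 ?_)
      have := (π.history_prefix x r rp (Nat.le_succ T) q).length_le
      rw [Nat.succ_eq_add_one] at this
      omega
    rw [numRead_history_succ]
    refine le_trans ?_ hmono
    split_ifs with h
    · obtain ⟨m, hm⟩ := Option.isSome_iff_exists.1 h
      have := getElem?_sent_of_readAt hm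
      exact (List.getElem?_eq_some_iff.1 this).1
    · simpa using ih

/-- `Stops` gives a time for each execution separately. The common schedule lets one reference
execution provide a uniform time, which makes the set of events finite. -/
lemma exists_forall_readAt_eq_none (hobl : π.Oblivious) (hStops : π.Stops) [∀ i, Nonempty (X i)]
    [∀ i, Nonempty (Ω i)] [Nonempty Ωp] :
    ∃ T₀, ∀ (x : ∀ i, X i) (r : ∀ i, Ω i) (rp : Ωp), ∀ T ≥ T₀, ∀ i q,
      π.readAt x r rp T i q = none := by
  let x₀ : ∀ i, X i := fun i => Classical.arbitrary _
  let r₀ : ∀ i, Ω i := fun i => Classical.arbitrary _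
  let p₀ : Ωp := Classical.arbitrary _
  have key : ∀ i q, ∀ᶠ T in Filter.atTop, π.readAt x₀ r₀ p₀ T i q = none := by
    intro i q
    obtain ⟨T₁, hT₁⟩ := hStops x₀ r₀ p₀
    have hmono : Monotone fun T => numRead (π.history x₀ r₀ p₀ T i) q :=
      monotone_nat_of_le_succ fun T => by
        rw [numRead_history_succ]; exact Nat.le_add_right _ _
    have hbdd : BddAbove (Set.range fun T => numRead (π.history x₀ r₀ p₀ T i) q) := by
      refine ⟨(π.sent x₀ r₀ p₀ T₁ q i).length, ?_⟩
      rintro _ ⟨T, rfl⟩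
      refine (hmono (le_max_left T T₁)).trans ?_
      rw [← hT₁ _ (le_max_right T T₁) q i]
      exact numRead_le_length_sent hobl _ _ _ _ _ _
    -- The number of reads on the link is monotone and bounded by the number of messages ever sent,
    -- so it attains its supremum; any later read would exceed it.
    obtain ⟨T₂, hT₂⟩ := Nat.sSup_mem (Set.range_nonempty _) hbdd
    filter_upwards [Filter.eventually_ge_atTop T₂] with T hT
    by_contra hne
    have h1 := numRead_history_succ (π := π) x₀ r₀ p₀ T i q
    rw [if_pos (Option.isSome_iff_ne_none.2 hne)] at h1
    have h2 := le_csSup hbdd ⟨T + 1, rfl⟩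
    have h3 := hmono hT
    simp only at h2 h3 hT₂
    omega
  have key' : ∀ᶠ T in Filter.atTop, ∀ i q, π.readAt x₀ r₀ p₀ T i q = none :=
    Filter.eventually_all.2 fun i => Filter.eventually_all.2 fun q => key i q
  obtain ⟨T₀, hT₀⟩ := Filter.eventually_atTop.1 key'
  refine ⟨T₀, fun x r rp T hT i q => ?_⟩
  have := isSome_readAt_eq hobl x x₀ r r₀ rp p₀ T i q
  rw [hT₀ T hT i q] at this
  simpa using this

section Stable

lemma transcriptAt_stable {T₀ : ℕ} {x : ∀ i, X i} {r : ∀ i, Ω i} {rp : Ωp} {i : Fin k}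
    (h : ∀ T ≥ T₀, ∀ q, π.readAt x r rp T i q = none) {T : ℕ} (hT : T₀ ≤ T) :
    π.transcriptAt x r rp i T = π.transcriptAt x r rp i T₀ := by
  induction T, hT using Nat.le_induction with
  | base => rfl
  | succ T hT ih =>
    rw [transcriptAt_succ, ih]
    simp [h T hT]

lemma playerTranscript_eq {T₀ : ℕ} {x : ∀ i, X i} {r : ∀ i, Ω i} {rp : Ωp} {i : Fin k}
    (h : ∀ T ≥ T₀, ∀ q, π.readAt x r rp T i q = none) :
    π.playerTranscript x r rp i = π.transcriptAt x r rp i T₀ := by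
  have hex : ∃ s, ∀ᶠ T in Filter.atTop, π.transcriptAt x r rp i T = s :=
    ⟨_, Filter.eventually_atTop.2 ⟨T₀, fun T hT => transcriptAt_stable h hT⟩⟩
  unfold playerTranscript
  rw [dif_pos hex]
  obtain ⟨T₁, hT₁⟩ := Filter.eventually_atTop.1 hex.choose_spec
  rw [← hT₁ _ (le_max_right T₀ T₁), transcriptAt_stable h (le_max_left T₀ T₁)]

/-- The players' transcripts determine the messages read. -/
lemma readAt_eq_of_playerTranscript_eq (hobl : π.Oblivious) (hsd : π.SelfDelimiting) {T₀ : ℕ}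
    (h₀ : ∀ (x : ∀ i, X i) (r : ∀ i, Ω i) (rp : Ωp), ∀ T ≥ T₀, ∀ i q,
      π.readAt x r rp T i q = none)
    {x x' : ∀ i, X i} {r r' : ∀ i, Ω i} {rp rp' : Ωp} {i : Fin k}
    (h : π.playerTranscript x r rp i = π.playerTranscript x' r' rp' i) (t : ℕ) (q : Fin k) :
    π.readAt x r rp t i q = π.readAt x' r' rp' t i q := by
  rcases le_or_gt T₀ t with ht | ht
  · rw [h₀ _ _ _ _ ht, h₀ _ _ _ _ ht]
  rw [playerTranscript_eq (fun T hT q => h₀ x r rp T hT i q),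
    playerTranscript_eq (fun T hT q => h₀ x' r' rp' T hT i q), transcriptAt_eq_flatMap,
    transcriptAt_eq_flatMap] at h
  -- Flatten time and sender into a single list of slots, the form in which unique decoding applies.
  have e : ∀ F : ℕ → Fin k → Option (List Bool),
      ((List.range T₀).flatMap fun t => (List.finRange k).flatMap fun q => (F t q).getD []) =
      (((List.range T₀).flatMap fun t => (List.finRange k).map fun q => (t, q))).flatMap
        fun e => (F e.1 e.2).getD [] := by
    intro F
    simp [List.flatMap_assoc, List.flatMap_map]
  rw [e fun t q => π.readAt x r rp t i q, e fun t q => π.readAt x' r' rp' t i q] at h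
  refine List.flatMap_getD_inj _ (fun e => π.readAt x r rp e.1 i e.2)
    (fun e => π.readAt x' r' rp' e.1 i e.2) (fun e _ => isSome_readAt_eq hobl _ _ _ _ _ _ _ _ _)
    (fun e _ m m' hm hm' => readAt_eq_of_prefix hobl hsd hm hm') h (t, q) ?_
  simp [ht]

lemma playerTranscript_eq_of_readAt_eq {T₀ : ℕ}
    (h₀ : ∀ (x : ∀ i, X i) (r : ∀ i, Ω i) (rp : Ωp), ∀ T ≥ T₀, ∀ i q,
      π.readAt x r rp T i q = none)
    {x x' : ∀ i, X i} {r r' : ∀ i, Ω i} {rp rp' : Ωp} {i : Fin k}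
    (h : ∀ t < T₀, ∀ q, π.readAt x r rp t i q = π.readAt x' r' rp' t i q) :
    π.playerTranscript x r rp i = π.playerTranscript x' r' rp' i := by
  rw [playerTranscript_eq (fun T hT q => h₀ x r rp T hT i q),
    playerTranscript_eq (fun T hT q => h₀ x' r' rp' T hT i q), transcriptAt_eq_flatMap,
    transcriptAt_eq_flatMap]
  refine List.flatMap_congr fun t ht => List.flatMap_congr fun q _ => ?_
  rw [h t (List.mem_range.1 ht) q]

/-- The transcript of the protocol determines the transcript of every player. -/
lemma playerTranscript_eq_of_transcript_eq (hobl : π.Oblivious) (hsd : π.SelfDelimiting) {T₀ : ℕ}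
    (h₀ : ∀ (x : ∀ i, X i) (r : ∀ i, Ω i) (rp : Ωp), ∀ T ≥ T₀, ∀ i q,
      π.readAt x r rp T i q = none)
    {x x' : ∀ i, X i} {r r' : ∀ i, Ω i} {rp rp' : Ωp}
    (h : π.transcript x r rp = π.transcript x' r' rp') (i : Fin k) :
    π.playerTranscript x r rp i = π.playerTranscript x' r' rp' i := by
  have e : ∀ (x : ∀ i, X i) (r : ∀ i, Ω i) (rp : Ωp), π.transcript x r rp =
      ((List.finRange k).flatMap fun i => (List.range T₀).flatMap fun t =>
        (List.finRange k).map fun q => (i, t, q)).flatMap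
        fun e => (π.readAt x r rp e.2.1 e.1 e.2.2).getD [] := by
    intro x r rp
    simp only [transcript, playerTranscript_eq (fun T hT q => h₀ x r rp T hT _ q),
      transcriptAt_eq_flatMap, List.flatMap_assoc, List.flatMap_map]
  rw [e, e] at h
  refine playerTranscript_eq_of_readAt_eq h₀ fun t ht q => ?_
  refine List.flatMap_getD_inj _ (fun e => π.readAt x r rp e.2.1 e.1 e.2.2)
    (fun e => π.readAt x' r' rp' e.2.1 e.1 e.2.2)
    (fun e _ => isSome_readAt_eq hobl _ _ _ _ _ _ _ _ _)
    (fun e _ m m' hm hm' => readAt_eq_of_prefix hobl hsd hm hm') h (i, t, q) ?_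
  simp [ht]

end Stable

/-! ### Outputs -/

lemma Writes.unique (hone : π.WritesAtMostOnce) {x : ∀ i, X i} {r : ∀ i, Ω i} {rp : Ωp} {i : Fin k}
    {j j' : ℕ} {y y' : Y i} (h : π.Writes x r rp i j y) (h' : π.Writes x r rp i j' y') :
    y = y' := by
  obtain rfl := hone x r rp i j j' y y' h h'
  obtain ⟨T, hj, hy⟩ := h
  obtain ⟨T', hj', hy'⟩ := h'
  -- Histories only grow, so the view at the start of round `j + 1` does not depend on the witness
  -- time.
  have : (π.history x r rp T i).take j = (π.history x r rp T' i).take j := by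
    rcases le_total T T' with hT | hT
    · rw [List.prefix_iff_eq_take.1 (π.history_prefix x r rp hT i), List.take_take, min_eq_left hj]
    · rw [List.prefix_iff_eq_take.1 (π.history_prefix x r rp hT i), List.take_take, min_eq_left hj']
  rw [this, hy'] at hy
  exact (Option.some_injective _ hy).symm

/-- The output of a player is a function of its input, its randomness and what it reads. -/
lemma Writes.eq_of_readAt_eq (hobl : π.Oblivious) (hone : π.WritesAtMostOnce) {x x' : ∀ i, X i}
    {r r' : ∀ i, Ω i} {rp : Ωp} {i : Fin k} {j j' : ℕ} {y y' : Y i}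
    (h : π.Writes x r rp i j y) (h' : π.Writes x' r' rp i j' y') (hx : x i = x' i)
    (hr : r i = r' i) (hread : ∀ t q, π.readAt x r rp t i q = π.readAt x' r' rp t i q) :
    y = y' := by
  refine Writes.unique hone (j := j) ?_ h'
  obtain ⟨T, hj, hy⟩ := h
  refine ⟨T, ?_⟩
  rw [← history_congr hobl fun t _ q => hread t q]
  simpa only [viewAt, hx, hr] using And.intro hj hy

end Protocol

/-! ### Entropy of partitions of a finite uniform space -/

section PartitionEntropy

variable {X : Type*} [Fintype X]

open Classical in
/-- The number of elements equivalent to `x`. -/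
noncomputable def classCard (S : Setoid X) (x : X) : ℕ := (Finset.univ.filter fun y => S x y).card

/-- The sum over all points of the logarithm of the size of their equivalence class. -/
noncomputable def logClassSum (S : Setoid X) : ℝ := ∑ x, Real.log (classCard S x)

lemma classCard_pos (S : Setoid X) (x : X) : 0 < classCard S x := by
  classical
  exact Finset.card_pos.2 ⟨x, by simp⟩

lemma classCard_congr (S : Setoid X) {x y : X} (h : S x y) : classCard S x = classCard S y := by
  classical
  unfold classCard
  congr 1
  ext z
  simp only [Finset.mem_filter, Finset.mem_univ, true_and]
  exact ⟨fun hz => S.trans (S.symm h) hz, fun hz => S.trans h hz⟩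

open Classical in
lemma sum_inv_classCard_le_one (S : Setoid X) (s : Finset X) (hs : ∀ x ∈ s, ∀ y ∈ s, S x y) :
    ∑ x ∈ s, ((classCard S x : ℝ))⁻¹ ≤ 1 := by
  rcases s.eq_empty_or_nonempty with rfl | ⟨x₀, hx₀⟩
  · simp
  · have h1 : ∀ x ∈ s, ((classCard S x : ℝ))⁻¹ = ((classCard S x₀ : ℝ))⁻¹ := fun x hx => by
      rw [classCard_congr S (hs x hx x₀ hx₀)]
    rw [Finset.sum_congr rfl h1, Finset.sum_const, nsmul_eq_mul, ← div_eq_mul_inv,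
      div_le_one (by exact_mod_cast classCard_pos S x₀)]
    have : s ⊆ Finset.univ.filter fun y => S x₀ y := fun y hy => by
      simpa using hs x₀ hx₀ y hy
    exact_mod_cast Finset.card_le_card this

/-- Submodularity: conditioning on a finer partition decreases conditional entropy. -/
lemma logClassSum_submodular (A : Setoid X) {B C : Setoid X} (hCB : C ≤ B) :
    logClassSum (A ⊓ B) + logClassSum C ≤ logClassSum B + logClassSum (A ⊓ C) := by
  classical
  have pos : ∀ (S : Setoid X) x, (0 : ℝ) < classCard S x := fun S x => by
    exact_mod_cast classCard_pos S x
  -- As log t ≤ t - 1, it suffices that these ratios have mean at most 1. The two numerators are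
  -- expanded into counts of `y` in the `A ⊓ B` class of `x` and of `z` in its `C` class.
  have key : ∑ x, ((classCard (A ⊓ B) x : ℝ) * classCard C x * ((classCard B x : ℝ))⁻¹ *
      ((classCard (A ⊓ C) x : ℝ))⁻¹) ≤ Fintype.card X := by
    have e1 : ∀ x, ((classCard (A ⊓ B) x : ℝ) * classCard C x * ((classCard B x : ℝ))⁻¹ *
        ((classCard (A ⊓ C) x : ℝ))⁻¹) = ∑ y, ∑ z, if (A ⊓ B) x y ∧ C x z then
          ((classCard B y : ℝ))⁻¹ * ((classCard (A ⊓ C) x : ℝ))⁻¹ else 0 := by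
      intro x
      have : ∀ y z, (if (A ⊓ B) x y ∧ C x z then
          ((classCard B y : ℝ))⁻¹ * ((classCard (A ⊓ C) x : ℝ))⁻¹ else 0) =
          (if (A ⊓ B) x y then 1 else 0) * (if C x z then 1 else 0) *
            (((classCard B x : ℝ))⁻¹ * ((classCard (A ⊓ C) x : ℝ))⁻¹) := by
        intro y z
        by_cases h1 : (A ⊓ B) x y <;> by_cases h2 : C x z <;> simp only [h1, h2, and_self,
          and_true, and_false, if_true, if_false, one_mul, mul_one, zero_mul, mul_zero]
        rw [classCard_congr B h1.2]
      simp_rw [this, ← Finset.sum_mul, ← Finset.mul_sum, ← Finset.sum_mul]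
      simp only [Finset.sum_boole, classCard]
      ring
    simp_rw [e1]
    rw [Finset.sum_comm]
    -- For fixed `y` and `z`, the admissible `x` lie in one class of `A ⊓ C`, so their inverse class
    -- sizes sum to at most 1. Since `C ≤ B`, only the `z` in the `B` class of `y` contribute, each
    -- at most the inverse size of that class.
    have e2 : ∀ y, ∑ x, ∑ z, (if (A ⊓ B) x y ∧ C x z then
          ((classCard B y : ℝ))⁻¹ * ((classCard (A ⊓ C) x : ℝ))⁻¹ else 0) ≤ 1 := by
      intro y
      rw [Finset.sum_comm]
      have e3 : ∀ z, ∑ x, (if (A ⊓ B) x y ∧ C x z then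
          ((classCard B y : ℝ))⁻¹ * ((classCard (A ⊓ C) x : ℝ))⁻¹ else 0) ≤
          if B y z then ((classCard B y : ℝ))⁻¹ else 0 := by
        intro z
        split_ifs with hyz
        · rw [← Finset.sum_filter, ← Finset.mul_sum]
          refine mul_le_of_le_one_right (inv_nonneg.2 (pos B y).le)
            (sum_inv_classCard_le_one _ _ ?_)
          intro x hx x' hx'
          simp only [Finset.mem_filter, Finset.mem_univ, true_and] at hx hx'
          exact ⟨A.trans hx.1.1 (A.symm hx'.1.1), C.trans hx.2 (C.symm hx'.2)⟩
        · refine le_of_eq (Finset.sum_eq_zero fun x _ => if_neg ?_)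
          rintro ⟨h1, h2⟩
          exact hyz (B.trans (B.symm h1.2) (hCB h2))
      refine (Finset.sum_le_sum fun z _ => e3 z).trans ?_
      rw [← Finset.sum_filter, Finset.sum_const, nsmul_eq_mul]
      exact le_of_eq (mul_inv_cancel₀ (pos B y).ne')
    refine (Finset.sum_le_sum fun y _ => e2 y).trans ?_
    simp
  have hlog : ∀ x, Real.log (classCard (A ⊓ B) x) + Real.log (classCard C x) -
      Real.log (classCard B x) - Real.log (classCard (A ⊓ C) x) ≤
      ((classCard (A ⊓ B) x : ℝ) * classCard C x * ((classCard B x : ℝ))⁻¹ *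
      ((classCard (A ⊓ C) x : ℝ))⁻¹) - 1 := by
    intro x
    have h1 := pos (A ⊓ B) x
    have h2 := pos C x
    have h3 := pos B x
    have h4 := pos (A ⊓ C) x
    have := Real.log_le_sub_one_of_pos (mul_pos (mul_pos (mul_pos h1 h2) (inv_pos.2 h3))
      (inv_pos.2 h4))
    rw [Real.log_mul (by positivity) (by positivity), Real.log_mul (by positivity) (by positivity),
      Real.log_mul (by positivity) (by positivity), Real.log_inv, Real.log_inv] at this
    linarith
  have hsum := Finset.sum_le_sum fun x (_ : x ∈ Finset.univ) => hlog x
  simp only [Finset.sum_sub_distrib, Finset.sum_add_distrib, Finset.sum_const, nsmul_eq_mul,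
    Finset.card_univ, mul_one] at hsum
  unfold logClassSum
  linarith

end PartitionEntropy

/-! ### Information sent and received in a deterministic protocol -/

section Events

variable {κ A ι β : Type*}

/-- Inputs that agree for player `i` and in the events of `s` received by `i`. -/
def receivedSetoid (dst : ι → κ) (M : ι → (κ → A) → β) (s : Finset ι) (i : κ) :
    Setoid (κ → A) where
  r x y := x i = y i ∧ ∀ u ∈ s, dst u = i → M u x = M u y
  iseqv := ⟨fun _ => ⟨rfl, fun _ _ _ => rfl⟩,
    fun h => ⟨h.1.symm, fun u hu hd => (h.2 u hu hd).symm⟩,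
    fun h h' => ⟨h.1.trans h'.1, fun u hu hd => (h.2 u hu hd).trans (h'.2 u hu hd)⟩⟩

/-- Inputs that agree for all players but `j` and in the events of `s` sent by `j`. -/
def sentSetoid (src : ι → κ) (M : ι → (κ → A) → β) (s : Finset ι) (j : κ) :
    Setoid (κ → A) where
  r x y := (∀ l, l ≠ j → x l = y l) ∧ ∀ u ∈ s, src u = j → M u x = M u y
  iseqv := ⟨fun _ => ⟨fun _ _ => rfl, fun _ _ _ => rfl⟩,
    fun h => ⟨fun l hl => (h.1 l hl).symm, fun u hu hd => (h.2 u hu hd).symm⟩,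
    fun h h' => ⟨fun l hl => (h.1 l hl).trans (h'.1 l hl),
      fun u hu hd => (h.2 u hu hd).trans (h'.2 u hu hd)⟩⟩

lemma receivedSetoid_iff {dst : ι → κ} {M : ι → (κ → A) → β} {s : Finset ι} {i : κ}
    {x y : κ → A} : receivedSetoid dst M s i x y ↔
      x i = y i ∧ ∀ u ∈ s, dst u = i → M u x = M u y := Iff.rfl

lemma sentSetoid_iff {src : ι → κ} {M : ι → (κ → A) → β} {s : Finset ι} {j : κ}
    {x y : κ → A} : sentSetoid src M s j x y ↔
      (∀ l, l ≠ j → x l = y l) ∧ ∀ u ∈ s, src u = j → M u x = M u y := Iff.rfl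

lemma receivedSetoid_insert_of_ne [DecidableEq ι] (dst : ι → κ)
    (M : ι → (κ → A) → β) (s : Finset ι) {a : ι}
    {i : κ} (h : dst a ≠ i) :
    receivedSetoid dst M (insert a s) i = receivedSetoid dst M s i := by
  ext x y
  simp only [receivedSetoid_iff, Finset.forall_mem_insert]
  tauto

lemma sentSetoid_insert_of_ne [DecidableEq ι] (src : ι → κ)
    (M : ι → (κ → A) → β) (s : Finset ι) {a : ι}
    {i : κ} (h : src a ≠ i) :
    sentSetoid src M (insert a s) i = sentSetoid src M s i := by
  ext x y
  simp only [sentSetoid_iff, Finset.forall_mem_insert]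
  tauto

lemma receivedSetoid_insert [DecidableEq ι] (dst : ι → κ)
    (M : ι → (κ → A) → β) (s : Finset ι) (a : ι) :
    receivedSetoid dst M (insert a s) (dst a) =
      Setoid.ker (M a) ⊓ receivedSetoid dst M s (dst a) := by
  ext x y
  simp only [Setoid.inf_def, Pi.inf_apply, Setoid.ker_def, inf_Prop_eq, receivedSetoid_iff,
    Finset.forall_mem_insert]
  tauto

lemma sentSetoid_insert [DecidableEq ι] (src : ι → κ)
    (M : ι → (κ → A) → β) (s : Finset ι) (a : ι) :
    sentSetoid src M (insert a s) (src a) =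
      Setoid.ker (M a) ⊓ sentSetoid src M s (src a) := by
  ext x y
  simp only [Setoid.inf_def, Pi.inf_apply, Setoid.ker_def, inf_Prop_eq, sentSetoid_iff,
    Finset.forall_mem_insert]
  tauto

/-- In a deterministic protocol, the information received by the players is at least the
information sent by the players. -/
lemma sum_logClassSum_sent_le_received [Fintype κ] [DecidableEq κ] [Fintype A]
    [DecidableEq ι] (src dst : ι → κ) (time : ι → ℕ) (M : ι → (κ → A) → β)
    (hself : ∀ t, src t = dst t → ∀ x y, M t x = M t y)
    (hdep : ∀ t x y, x (src t) = y (src t) →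
      (∀ u, dst u = src t → time u < time t → M u x = M u y) → M t x = M t y)
    (s : Finset ι) (hs : ∀ t ∈ s, ∀ u, time u < time t → u ∈ s) :
    ∑ j, (logClassSum (sentSetoid src M ∅ j) - logClassSum (sentSetoid src M s j)) ≤
      ∑ i, (logClassSum (receivedSetoid dst M ∅ i) - logClassSum (receivedSetoid dst M s i)) := by
  -- The added event is a latest one, so the remaining set is still closed under earlier events.
  induction s using Finset.induction_on_max_value time with
  | empty => simp
  | insert a s ha hmax ih =>
    have hs' : ∀ t ∈ s, ∀ u, time u < time t → u ∈ s := by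
      intro t ht u hu
      rcases Finset.mem_insert.1 (hs t (Finset.mem_insert_of_mem ht) u hu) with rfl | h
      · exact absurd (hmax t ht) (not_le.2 hu)
      · exact h
    have hprev : ∀ u, time u < time a → u ∈ s := by
      intro u hu
      rcases Finset.mem_insert.1 (hs a (Finset.mem_insert_self _ _) u hu) with rfl | h
      · exact absurd hu (lt_irrefl _)
      · exact h
    specialize ih hs'
    have hS : ∑ j, logClassSum (sentSetoid src M (insert a s) j) =
        ∑ j, logClassSum (sentSetoid src M s j) +
          (logClassSum (Setoid.ker (M a) ⊓ sentSetoid src M s (src a)) -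
            logClassSum (sentSetoid src M s (src a))) := by
      rw [← Finset.add_sum_erase _ _ (Finset.mem_univ (src a)), sentSetoid_insert,
        ← Finset.add_sum_erase _ (fun j => logClassSum (sentSetoid src M s j))
          (Finset.mem_univ (src a)),
        Finset.sum_congr rfl fun j hj => by
          rw [sentSetoid_insert_of_ne src M s (Finset.ne_of_mem_erase hj).symm]]
      ring
    have hR : ∑ j, logClassSum (receivedSetoid dst M (insert a s) j) =
        ∑ j, logClassSum (receivedSetoid dst M s j) +
          (logClassSum (Setoid.ker (M a) ⊓ receivedSetoid dst M s (dst a)) -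
            logClassSum (receivedSetoid dst M s (dst a))) := by
      rw [← Finset.add_sum_erase _ _ (Finset.mem_univ (dst a)), receivedSetoid_insert,
        ← Finset.add_sum_erase _ (fun j => logClassSum (receivedSetoid dst M s j))
          (Finset.mem_univ (dst a)),
        Finset.sum_congr rfl fun j hj => by
          rw [receivedSetoid_insert_of_ne dst M s (Finset.ne_of_mem_erase hj).symm]]
      ring
    -- The entropy of the new message given the receiver's view is at least its entropy given all
    -- inputs but the sender's and what the sender sent before.
    have hstep : logClassSum (Setoid.ker (M a) ⊓ receivedSetoid dst M s (dst a)) +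
        logClassSum (sentSetoid src M s (src a)) ≤
        logClassSum (receivedSetoid dst M s (dst a)) +
        logClassSum (Setoid.ker (M a) ⊓ sentSetoid src M s (src a)) := by
      by_cases hsd : src a = dst a
      · have : Setoid.ker (M a) = ⊤ := by
          ext x y
          simp [Setoid.ker_def, hself a hsd x y]
        rw [this, top_inf_eq, top_inf_eq]
      · refine logClassSum_submodular _ ?_
        intro x y hxy
        obtain ⟨h1, h2⟩ := hxy
        refine ⟨h1 _ (Ne.symm hsd), ?_⟩
        -- The sender's past messages agree by assumption. The others are recomputed from equal
        -- inputs by induction on time, so the conditioning on the sender's side refines the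
        -- receiver's view.
        suffices h : ∀ m, ∀ u ∈ s, time u = m → M u x = M u y from fun u hu _ => h _ u hu rfl
        intro m
        induction m using Nat.strong_induction_on with
        | _ m ihm =>
          intro u hu hum
          by_cases hsu : src u = src a
          · exact h2 u hu hsu
          · refine hdep u x y (h1 _ hsu) fun v _ hv => ihm _ (hum ▸ hv) v (hs' u hu v hv) rfl
    simp only [Finset.sum_sub_distrib] at ih ⊢
    rw [hS, hR]
    linarith

lemma classCard_sentSetoid_empty [Fintype κ] [DecidableEq κ] [Fintype A]
    (src : ι → κ) (M : ι → (κ → A) → β) (j : κ) (x : κ → A) :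
    classCard (sentSetoid src M ∅ j) x = Fintype.card A := by
  classical
  rw [← Finset.card_univ]
  refine (Finset.card_bij (fun b _ => Function.update x j b) ?_ ?_ ?_).symm
  · intro b _
    simp only [Finset.mem_filter, Finset.mem_univ, true_and, sentSetoid_iff]
    exact ⟨fun l hl => by simp [hl], by simp⟩
  · intro b _ c _ h
    simpa using congrFun h j
  · intro y hy
    simp only [Finset.mem_filter, Finset.mem_univ, true_and, sentSetoid_iff] at hy
    refine ⟨y j, Finset.mem_univ _, ?_⟩
    ext l
    by_cases hl : l = j
    · subst hl; simp
    · simp [hl, hy.1 l hl]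

/-- Only the bits of player `j` at its own coordinates remain free within the class. -/
lemma classCard_le_of_designated [Fintype κ] [DecidableEq κ] {n : ℕ} (a : Fin n → κ)
    (S : Setoid (κ → Fin n → Bool)) (j : κ)
    (x : κ → Fin n → Bool)
    (h : ∀ y, S x y → (∀ l, l ≠ j → x l = y l) ∧ ∀ p, a p ≠ j → x j p = y j p) :
    classCard S x ≤ 2 ^ Fintype.card {p // a p = j} := by
  classical
  have : 2 ^ Fintype.card {p // a p = j} =
      (Finset.univ : Finset ({p // a p = j} → Bool)).card := by simp
  rw [this]
  refine Finset.card_le_card_of_injOn (fun y p => y j p)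
    (fun _ _ => Finset.mem_coe.2 (Finset.mem_univ _)) ?_
  intro y hy z hz hyz
  simp only [Finset.coe_filter, Finset.mem_univ, true_and, Set.mem_ofPred_eq] at hy hz
  ext l p
  by_cases hl : l = j
  · subst hl
    by_cases hp : a p = l
    · exact congrFun hyz ⟨p, hp⟩
    · rw [← (h y hy).2 p hp, (h z hz).2 p hp]
  · rw [← (h y hy).1 l hl, (h z hz).1 l hl]

/-- The information received in a deterministic protocol that determines, for every player `j`,
the bits of its input designated to the others, from what it sends and the other inputs. -/
lemma le_sum_logClassSum_received {n : ℕ} [Fintype κ] [DecidableEq κ] [Fintype ι]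
    (a : Fin n → κ) (src dst : ι → κ)
    (time : ι → ℕ) (M : ι → (κ → Fin n → Bool) → β)
    (hself : ∀ t, src t = dst t → ∀ x y, M t x = M t y)
    (hdep : ∀ t x y, x (src t) = y (src t) →
      (∀ u, dst u = src t → time u < time t → M u x = M u y) → M t x = M t y)
    (hout : ∀ j x y, sentSetoid src M Finset.univ j x y → ∀ p, a p ≠ j → x j p = y j p) :
    (Fintype.card (κ → Fin n → Bool) : ℝ) * (((Fintype.card κ : ℝ) - 1) * n * Real.log 2) ≤
      ∑ i, (logClassSum (receivedSetoid dst M ∅ i) -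
        logClassSum (receivedSetoid dst M Finset.univ i)) := by
  classical
  refine le_trans ?_ (sum_logClassSum_sent_le_received src dst time M hself hdep Finset.univ
    (fun _ _ _ _ => Finset.mem_univ _))
  have h1 : ∀ j, logClassSum (sentSetoid src M ∅ j) =
      (Fintype.card (κ → Fin n → Bool) : ℝ) * (n * Real.log 2) := by
    intro j
    unfold logClassSum
    simp_rw [classCard_sentSetoid_empty]
    rw [Finset.sum_const, nsmul_eq_mul, Finset.card_univ]
    congr 1
    simp
  have h2 : ∀ j, logClassSum (sentSetoid src M Finset.univ j) ≤
      (Fintype.card (κ → Fin n → Bool) : ℝ) *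
        (Fintype.card {p // a p = j} * Real.log 2) := by
    intro j
    unfold logClassSum
    rw [← nsmul_eq_mul, ← Finset.card_univ]
    refine Finset.sum_le_card_nsmul _ _ _ fun x _ => ?_
    rw [← Real.log_pow]
    refine Real.log_le_log (by exact_mod_cast classCard_pos _ _) ?_
    exact_mod_cast classCard_le_of_designated a _ j x fun y hy =>
      ⟨(sentSetoid_iff.1 hy).1, hout j x y hy⟩
  have h3 : ∑ j, (Fintype.card {p // a p = j} : ℝ) = n := by
    rw [← Nat.cast_sum, ← Fintype.card_sigma, Fintype.card_congr (Equiv.sigmaFiberEquiv a)]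
    simp
  calc _ = ∑ j, ((Fintype.card (κ → Fin n → Bool) : ℝ) * (n * Real.log 2) -
        (Fintype.card (κ → Fin n → Bool) : ℝ) *
        (Fintype.card {p // a p = j} * Real.log 2)) := by
        rw [Finset.sum_sub_distrib, Finset.sum_const, nsmul_eq_mul, Finset.card_univ,
          ← Finset.mul_sum, ← Finset.sum_mul, h3]
        ring
    _ ≤ _ := Finset.sum_le_sum fun j _ => by rw [h1 j]; exact sub_le_sub_left (h2 j) _

end Events

/-! ### Parity, and the two counting bounds for it -/

lemma List.foldr_xor_update {α : Type*} [DecidableEq α] (L : List α) (hL : L.Nodup) (f : α → Bool)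
    {j : α} (hj : j ∈ L) (b : Bool) :
    (L.map (Function.update f j b)).foldr xor false =
      xor (xor (f j) b) ((L.map f).foldr xor false) := by
  induction L with
  | nil => simp at hj
  | cons c L ih =>
    obtain ⟨hc, hL'⟩ := List.nodup_cons.1 hL
    simp only [List.map_cons, List.foldr_cons]
    by_cases hcj : c = j
    · subst hcj
      have : L.map (Function.update f c b) = L.map f := by
        refine List.map_congr_left fun d hd => ?_
        rw [Function.update_of_ne (fun h : d = c => hc (h ▸ hd))]
      rw [this, Function.update_self]
      cases f c <;> cases b <;> cases (L.map f).foldr xor false <;> rfl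
    · have hj' : j ∈ L := by
        rcases List.mem_cons.1 hj with h | h
        · exact absurd h.symm hcj
        · exact h
      rw [ih hL' hj', Function.update_of_ne hcj]
      cases f c <;> cases f j <;> cases b <;> cases (L.map f).foldr xor false <;> rfl

lemma parity_update {k n : ℕ} (a : Fin n → Fin k) (i l : Fin k) (x : Fin k → Fin n → Bool)
    (w : Fin n → Bool) (p : {p : Fin n // a p = i}) :
    parity a i (Function.update x l w) p = xor (xor (x l p) (w p)) (parity a i x p) := by
  unfold parity
  rw [← List.foldr_xor_update _ (List.nodup_finRange k) (fun l => x l p) (List.mem_finRange l)]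
  congr 2
  ext m
  by_cases h : m = l
  · subst h; simp
  · simp [h]

namespace Protocol

/-- The lower bound for fixed tapes on which all inputs are answered correctly. Events are triples
of time below `T₀`, receiver and sender; triples with no message carry the constant `none`. -/
lemma le_sum_logClassSum_playerTranscript {k n : ℕ} (a : Fin n → Fin k) {Ω : Fin k → Type*}
    {Ωp : Type*}
    {π : Protocol k (fun _ => Fin n → Bool) (fun i => {p : Fin n // a p = i} → Bool) Ω Ωp}
    (hobl : π.Oblivious) (hsd : π.SelfDelimiting) (hone : π.WritesAtMostOnce) {T₀ : ℕ}
    (h₀ : ∀ x r rp, ∀ T ≥ T₀, ∀ i q, π.readAt x r rp T i q = none)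
    (r : ∀ i, Ω i) (rp : Ωp) (hcorr : ∀ x i, ∃ j, π.Writes x r rp i j (parity a i x)) :
    (Fintype.card (Fin k → Fin n → Bool) : ℝ) * (((k : ℝ) - 1) * n * Real.log 2) ≤
      ∑ i, (logClassSum (Setoid.ker fun x : Fin k → Fin n → Bool => x i) -
        logClassSum (Setoid.ker fun x => (x i, π.playerTranscript x r rp i))) := by
  let src : Fin T₀ × Fin k × Fin k → Fin k := fun e => e.2.2
  let dst : Fin T₀ × Fin k × Fin k → Fin k := fun e => e.2.1
  let time : Fin T₀ × Fin k × Fin k → ℕ := fun e => e.1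
  let M : Fin T₀ × Fin k × Fin k → (Fin k → Fin n → Bool) → Option (List Bool) :=
    fun e x => π.readAt x r rp e.1 e.2.1 e.2.2
  have hself : ∀ t, src t = dst t → ∀ x y, M t x = M t y := by
    rintro ⟨t, i, q⟩ h x y
    obtain rfl : q = i := h
    simp only [M, readAt_self]
  have hdep : ∀ t x y, x (src t) = y (src t) →
      (∀ u, dst u = src t → time u < time t → M u x = M u y) → M t x = M t y := by
    rintro ⟨t, i, q⟩ x y hxy hu
    refine readAt_congr hobl hxy rfl (history_congr hobl fun t' ht' q' => ?_) i
    exact hu (⟨t', ht'.trans t.2⟩, q, q') rfl ht'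
  -- Player `a p` differs from `j`, has the same input under `x` and `y` and reads the same
  -- messages, so it outputs the same parity; as only `x j` may change, its bit `p` cannot.
  have hout : ∀ j x y, sentSetoid src M Finset.univ j x y → ∀ p, a p ≠ j → x j p = y j p := by
    intro j x y hxy p hp
    obtain ⟨h1, h2⟩ := sentSetoid_iff.1 hxy
    have hread : ∀ t, ∀ i q, i ≠ j → π.readAt x r rp t i q = π.readAt y r rp t i q := by
      intro t
      induction t using Nat.strong_induction_on with
      | _ t ih =>
        intro i q hi
        rcases le_or_gt T₀ t with ht | ht
        · rw [h₀ _ _ _ _ ht, h₀ _ _ _ _ ht]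
        · by_cases hq : q = j
          · exact h2 (⟨t, ht⟩, i, q) (Finset.mem_univ _) hq
          · exact readAt_congr hobl (h1 q hq) rfl
              (history_congr hobl fun t' ht' q' => ih t' ht' q q' hq) i
    obtain ⟨j₁, hw₁⟩ := hcorr x (a p)
    obtain ⟨j₂, hw₂⟩ := hcorr y (a p)
    have hpar := hw₁.eq_of_readAt_eq hobl hone hw₂ (h1 _ hp) rfl fun t q => hread t _ q hp
    have hy : y = Function.update x j (y j) := by
      ext l
      by_cases hl : l = j
      · subst hl; simp
      · simp [hl, h1 l hl]
    have := congrFun hpar ⟨p, rfl⟩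
    rw [hy, parity_update] at this
    revert this
    cases x j p <;> cases y j p <;> cases parity a (a p) x ⟨p, rfl⟩ <;> simp
  have := le_sum_logClassSum_received a src dst time M hself hdep hout
  rw [Fintype.card_fin] at this
  convert this using 3 with i _ i _
  · congr 1
    ext x y
    simp [Setoid.ker_def, receivedSetoid_iff]
  · congr 1
    ext x y
    rw [receivedSetoid_iff, Setoid.ker_def, Prod.mk.injEq]
    refine and_congr_right fun _ => ⟨fun h => ?_, fun h => ?_⟩
    · rintro ⟨t, i', q⟩ _ rfl
      exact readAt_eq_of_playerTranscript_eq hobl hsd h₀ h t q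
    · exact playerTranscript_eq_of_readAt_eq h₀ fun t ht q =>
        h (⟨t, ht⟩, i, q) (Finset.mem_univ _) rfl

/-- A player's input and output value leave the inputs of the others undetermined up to a factor
given by the number of outputs. -/
lemma card_ker_le_mul_card_ker_parity {k n : ℕ} (hk : 2 ≤ k) (a : Fin n → Fin k) (i : Fin k)
    (x : Fin k → Fin n → Bool) :
    classCard (Setoid.ker fun x : Fin k → Fin n → Bool => x i) x ≤
      2 ^ Fintype.card {p // a p = i} *
        classCard (Setoid.ker fun x : Fin k → Fin n → Bool => (x i, parity a i x)) x := by
  classical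
  have : Nontrivial (Fin k) := Fin.nontrivial_iff_two_le.2 hk
  obtain ⟨l, hl⟩ := exists_ne i
  -- The input of another player `l` (this needs k ≥ 2) is corrected so that player `i` gets the
  -- output it has on `x`. The original output of `y` is kept alongside, which makes the correction
  -- reversible.
  let c : (Fin k → Fin n → Bool) → Fin n → Bool := fun y p =>
    if h : a p = i then xor (y l p) (xor (parity a i x ⟨p, h⟩) (parity a i y ⟨p, h⟩)) else y l p
  have hpar : ∀ y, parity a i (Function.update y l (c y)) = parity a i x := by
    intro y
    ext ⟨p, hp⟩
    rw [parity_update]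
    simp only [c, hp, dif_pos]
    cases y l p <;> cases parity a i x ⟨p, hp⟩ <;> cases parity a i y ⟨p, hp⟩ <;> rfl
  have hcard : 2 ^ Fintype.card {p // a p = i} *
      classCard (Setoid.ker fun x : Fin k → Fin n → Bool => (x i, parity a i x)) x =
      ((Finset.univ : Finset ({p // a p = i} → Bool)) ×ˢ (Finset.univ.filter fun y =>
        Setoid.ker (fun x : Fin k → Fin n → Bool => (x i, parity a i x)) x y)).card := by
    rw [Finset.card_product]
    congr 1
    · simp
  rw [hcard]
  refine Finset.card_le_card_of_injOn
    (fun y => (parity a i y, Function.update y l (c y))) ?_ ?_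
  · intro y hy
    simp only [Finset.coe_filter, Finset.mem_univ, true_and, Set.mem_ofPred_eq,
      Setoid.ker_def] at hy
    simp only [Finset.coe_product, Finset.coe_univ, Finset.coe_filter, Finset.mem_univ, true_and,
      Set.mem_prod, Set.mem_univ, Set.mem_ofPred_eq, Setoid.ker_def, Prod.mk.injEq]
    exact ⟨by rw [Function.update_of_ne hl.symm, hy], (hpar y).symm⟩
  · intro y _ z _ h
    obtain ⟨h1, h2⟩ := Prod.mk.inj h
    ext m p
    by_cases hm : m = l
    · subst hm
      have h3 := congrFun (congrFun h2 m) p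
      simp only [Function.update_self, c, h1] at h3
      split_ifs at h3 with hp
      · revert h3
        cases y m p <;> cases z m p <;>
          cases xor (parity a i x ⟨p, hp⟩) (parity a i z ⟨p, hp⟩) <;> simp
      · exact h3
    · have h3 := congrFun (congrFun h2 m) p
      simpa [hm] using h3

end Protocol

/-! ### Entropy of discrete random variables -/

/-- The summand `p log₂ (1/p)` of the binary entropy. -/
noncomputable def entropyTerm (p : ℝ) : ℝ≥0∞ := ENNReal.ofReal (Real.negMulLog p / Real.log 2)

/-- The number of bits of information `log₂ (1/p)` of an event of probability `p`. -/
noncomputable def infoBits (p : ℝ) : ℝ≥0∞ := ENNReal.ofReal (-Real.log p / Real.log 2)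

lemma entropyTerm_eq {p : ℝ} (h0 : 0 ≤ p) : entropyTerm p = ENNReal.ofReal p * infoBits p := by
  rw [entropyTerm, infoBits, ← ENNReal.ofReal_mul h0]
  congr 1
  rw [Real.negMulLog]
  ring

lemma infoBits_anti {p q : ℝ} (hp : 0 < p) (h : p ≤ q) : infoBits q ≤ infoBits p := by
  refine ENNReal.ofReal_le_ofReal (div_le_div_of_nonneg_right ?_ (Real.log_nonneg one_le_two))
  exact neg_le_neg (Real.log_le_log hp h)

lemma measurable_entropyTerm : Measurable entropyTerm :=
  ENNReal.measurable_ofReal.comp (Real.continuous_negMulLog.measurable.div_const _)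

/-- Jensen for the concave function -p log p. Summed over values, this says that conditioning on
randomness does not increase entropy. -/
lemma lintegral_entropyTerm_le {Ω : Type*} [MeasurableSpace Ω] (μ : Measure Ω)
    [IsProbabilityMeasure μ] {g : Ω → ℝ} (hg : Measurable g) (h0 : ∀ ω, 0 ≤ g ω)
    (h1 : ∀ ω, g ω ≤ 1) : ∫⁻ ω, entropyTerm (g ω) ∂μ ≤ entropyTerm (∫ ω, g ω ∂μ) := by
  have hgi : Integrable g μ := Integrable.of_bound hg.aestronglyMeasurable 1
    (Filter.Eventually.of_forall fun ω => by
      rw [Real.norm_eq_abs, abs_of_nonneg (h0 ω)]; exact h1 ω)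
  have hm : Measurable fun ω => Real.negMulLog (g ω) := Real.continuous_negMulLog.measurable.comp hg
  have hni : Integrable (Real.negMulLog ∘ g) μ := by
    refine Integrable.of_bound hm.aestronglyMeasurable 1 (Filter.Eventually.of_forall fun ω => ?_)
    rw [Function.comp_apply, Real.norm_eq_abs, abs_of_nonneg (Real.negMulLog_nonneg (h0 ω) (h1 ω))]
    have := Real.negMulLog_le_one_sub_self (h0 ω)
    linarith [h0 ω]
  have hJ := Real.concaveOn_negMulLog.le_map_integral Real.continuous_negMulLog.continuousOn
    isClosed_Ici (Filter.Eventually.of_forall h0) hgi hni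
  have hni' : Integrable (fun ω => Real.negMulLog (g ω) / Real.log 2) μ := hni.div_const _
  unfold entropyTerm
  rw [← ofReal_integral_eq_lintegral_ofReal hni' (Filter.Eventually.of_forall
    fun ω => div_nonneg (Real.negMulLog_nonneg (h0 ω) (h1 ω)) (Real.log_nonneg one_le_two))]
  refine ENNReal.ofReal_le_ofReal ?_
  rw [integral_div]
  exact div_le_div_of_nonneg_right hJ (Real.log_nonneg one_le_two)

lemma entropy_eq_tsum {Ω α : Type*} [MeasurableSpace Ω] (P : Measure Ω) (Z : Ω → α) :
    entropy P Z = ∑' a, entropyTerm (P.real (Z ⁻¹' {a})) := rfl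

/-- A function of a discrete random variable has at most its entropy. -/
lemma entropy_le_of_determined {Ω α β : Type*} [MeasurableSpace Ω] [Countable β] (P : Measure Ω)
    [IsProbabilityMeasure P] (Z : Ω → α) (W : Ω → β) (h : ∀ ω ω', W ω = W ω' → Z ω = Z ω') :
    entropy P Z ≤ entropy P W := by
  rw [entropy_eq_tsum, entropy_eq_tsum]
  -- Split {Z = a} along the values of `W`. Where a piece is not null, {W = b} lies inside {Z = a},
  -- hence is rarer and carries more bits. Subadditivity is enough, so no measurability enters.
  have h1 : ∀ a, entropyTerm (P.real (Z ⁻¹' {a})) ≤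
      ∑' b, P (W ⁻¹' {b} ∩ Z ⁻¹' {a}) * infoBits (P.real (W ⁻¹' {b})) := by
    intro a
    rw [entropyTerm_eq measureReal_nonneg, ofReal_measureReal]
    have : P (Z ⁻¹' {a}) ≤ ∑' b, P (W ⁻¹' {b} ∩ Z ⁻¹' {a}) := by
      refine le_trans (measure_mono ?_) (measure_iUnion_le _)
      intro ω hω
      exact Set.mem_iUnion.2 ⟨W ω, rfl, hω⟩
    refine (mul_le_mul_left this _).trans ?_
    rw [← ENNReal.tsum_mul_right]
    refine ENNReal.tsum_le_tsum fun b => ?_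
    by_cases hb : P (W ⁻¹' {b} ∩ Z ⁻¹' {a}) = 0
    · simp [hb]
    · refine mul_le_mul_right (infoBits_anti ?_ ?_) _
      · rw [measureReal_def]
        refine ENNReal.toReal_pos (fun h0 => hb ?_) (measure_ne_top _ _)
        exact measure_mono_null Set.inter_subset_left h0
      · obtain ⟨ω, hω, hω'⟩ := nonempty_of_measure_ne_zero hb
        refine measureReal_mono fun ω' hb' => ?_
        have := h ω' ω (Eq.trans hb' (Eq.symm hω))
        exact Eq.trans this hω'
  refine (ENNReal.tsum_le_tsum h1).trans ?_
  rw [ENNReal.tsum_comm]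
  refine ENNReal.tsum_le_tsum fun b => ?_
  rw [ENNReal.tsum_mul_right, entropyTerm_eq measureReal_nonneg, ofReal_measureReal]
  refine mul_le_mul_left ?_ _
  rcases (W ⁻¹' {b}).eq_empty_or_nonempty with he | ⟨ω, hω⟩
  · simp [he]
  · rw [tsum_eq_single (Z ω)]
    · exact measure_mono Set.inter_subset_left
    · intro a ha
      convert measure_empty (μ := P)
      ext ω'
      simp only [Set.mem_inter_iff, Set.mem_preimage, Set.mem_singleton_iff,
        Set.mem_empty_iff_false, iff_false, not_and]
      intro hb hz
      exact ha (hz ▸ h ω' ω (Eq.trans hb (Eq.symm hω)))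

/-- Checked on boxes: the overwritten coordinate is unconstrained and has mass 1. This connects the
overwritten tape in `IsPrivate` with integration over all private tapes. -/
lemma measurePreserving_update {κ : Type*} [Fintype κ] [DecidableEq κ] {Ω : κ → Type*}
    [∀ i, MeasurableSpace (Ω i)] (P : ∀ i, Measure (Ω i)) [∀ i, IsProbabilityMeasure (P i)]
    (i : κ) : MeasurePreserving (fun ω : Ω i × (∀ j, Ω j) => Function.update ω.2 i ω.1)
      ((P i).prod (Measure.pi P)) (Measure.pi P) := by
  have hm : Measurable fun ω : Ω i × (∀ j, Ω j) => Function.update ω.2 i ω.1 := by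
    refine measurable_pi_lambda _ fun j => ?_
    by_cases hj : j = i
    · subst hj; simpa using measurable_fst
    · simpa [hj, Function.comp_def] using (measurable_pi_apply j).comp measurable_snd
  refine ⟨hm, (Measure.pi_eq fun s hs => ?_).symm⟩
  rw [Measure.map_apply hm (MeasurableSet.univ_pi hs)]
  have : (fun ω : Ω i × (∀ j, Ω j) => Function.update ω.2 i ω.1) ⁻¹' Set.univ.pi s =
      s i ×ˢ Set.univ.pi (Function.update s i Set.univ) := by
    ext ⟨ρ, r⟩
    simp only [Set.mem_preimage, Set.mem_pi, Set.mem_univ, true_implies, Set.mem_prod]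
    constructor
    · intro h
      refine ⟨by simpa using h i, fun j => ?_⟩
      by_cases hj : j = i
      · subst hj; simp
      · simpa [hj] using h j
    · rintro ⟨h1, h2⟩ j
      by_cases hj : j = i
      · subst hj; simpa using h1
      · simpa [hj] using h2 j
  rw [this, Measure.prod_prod, Measure.pi_pi, ← Finset.mul_prod_erase _ _ (Finset.mem_univ i),
    ← Finset.mul_prod_erase _ (fun j => P j (s j)) (Finset.mem_univ i), Function.update_self,
    measure_univ, one_mul]
  congr 1
  refine Finset.prod_congr rfl fun j hj => ?_
  rw [Function.update_of_ne (Finset.ne_of_mem_erase hj)]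

/-! ### Averaging laws over classes of inputs -/

section Average

variable {X : Type*} [Fintype X]

open Classical in
/-- The average of a function over the equivalence class of `x`. -/
noncomputable def classAverage (S : Setoid X) (q : X → ℝ) (x : X) : ℝ :=
  (∑ y, if S x y then q y else 0) / classCard S x

lemma classAverage_congr (S : Setoid X) (q : X → ℝ) {x y : X} (h : S x y) :
    classAverage S q x = classAverage S q y := by
  unfold classAverage
  rw [classCard_congr S h]
  congr 1
  refine Finset.sum_congr rfl fun z _ => ?_
  have : S x z ↔ S y z := ⟨fun hz => S.trans (S.symm h) hz, fun hz => S.trans h hz⟩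
  by_cases hz : S x z
  · rw [if_pos hz, if_pos (this.1 hz)]
  · rw [if_neg hz, if_neg fun h => hz (this.2 h)]

lemma classAverage_nonneg (S : Setoid X) {q : X → ℝ} (h : ∀ x, 0 ≤ q x) (x : X) :
    0 ≤ classAverage S q x := by
  refine div_nonneg (Finset.sum_nonneg fun y _ => ?_) (Nat.cast_nonneg _)
  split_ifs
  exacts [h y, le_rfl]

lemma classAverage_le_one (S : Setoid X) {q : X → ℝ} (h : ∀ x, q x ≤ 1) (x : X) :
    classAverage S q x ≤ 1 := by
  classical
  refine div_le_one_of_le₀ ?_ (Nat.cast_nonneg _)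
  unfold classCard
  rw [← Finset.sum_filter]
  exact (Finset.sum_le_card_nsmul _ _ 1 fun y _ => h y).trans_eq (by simp)

/-- The defining property of a conditional expectation, tested against class-constant functions, by
double counting pairs of equivalent points. -/
lemma sum_classAverage_mul (S : Setoid X) {q : X → ℝ} (hq : ∀ x, 0 ≤ q x) (h : X → ℝ≥0∞)
    (hh : ∀ x y, S x y → h x = h y) :
    ∑ x, ENNReal.ofReal (classAverage S q x) * h x = ∑ x, ENNReal.ofReal (q x) * h x := by
  classical
  have e1 : ∀ x, ENNReal.ofReal (classAverage S q x) * h x =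
      ∑ y, if S x y then ENNReal.ofReal (q y) * h y * (classCard S y : ℝ≥0∞)⁻¹ else 0 := by
    intro x
    have hc : (0 : ℝ) < classCard S x := by exact_mod_cast classCard_pos S x
    have h2 : ∀ y, 0 ≤ if S x y then q y else 0 := fun y => by split_ifs; exacts [hq y, le_rfl]
    rw [classAverage, ENNReal.ofReal_div_of_pos hc, ENNReal.ofReal_sum_of_nonneg fun y _ => h2 y,
      ENNReal.ofReal_natCast, div_eq_mul_inv, mul_assoc, Finset.sum_mul]
    refine Finset.sum_congr rfl fun y _ => ?_
    split_ifs with hxy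
    · rw [classCard_congr S hxy, hh x y hxy]; ring
    · simp
  simp_rw [e1]
  rw [Finset.sum_comm]
  refine Finset.sum_congr rfl fun y _ => ?_
  rw [← Finset.sum_filter, Finset.sum_const, nsmul_eq_mul]
  have : (Finset.univ.filter fun x => S x y).card = classCard S y := by
    unfold classCard
    congr 1
    ext z
    simp only [Finset.mem_filter, Finset.mem_univ, true_and]
    exact ⟨fun h => S.symm h, fun h => S.symm h⟩
  rw [this, mul_comm, mul_assoc, ENNReal.inv_mul_cancel, mul_one]
  · exact_mod_cast (classCard_pos S y).ne'
  · exact ENNReal.natCast_ne_top _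

lemma sum_entropyTerm_classAverage (S : Setoid X) {q : X → ℝ} (h0 : ∀ x, 0 ≤ q x) :
    ∑ x, entropyTerm (classAverage S q x) =
      ∑ x, ENNReal.ofReal (q x) * infoBits (classAverage S q x) := by
  rw [← sum_classAverage_mul S h0 _ fun x y h => by rw [classAverage_congr S q h]]
  exact Finset.sum_congr rfl fun x _ => entropyTerm_eq (classAverage_nonneg S h0 x)

/-- The entropy of a mixture of laws exceeds the mean entropy by at most `log₂ N` if it is
a uniform mixture of `N` laws. -/
lemma sum_entropyTerm_classAverage_le {S S' : Setoid X} (hS : S' ≤ S) {N : ℕ}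
    (hN : ∀ x, classCard S x ≤ N * classCard S' x) {q : X → ℝ} (h0 : ∀ x, 0 ≤ q x)
    (hq : ∀ x y, S' x y → q x = q y) :
    ∑ x, entropyTerm (classAverage S q x) ≤
      ∑ x, (entropyTerm (q x) + ENNReal.ofReal (Real.log N / Real.log 2) *
        ENNReal.ofReal (q x)) := by
  classical
  rw [sum_entropyTerm_classAverage S h0]
  refine Finset.sum_le_sum fun x _ => ?_
  rcases (h0 x).eq_or_lt with hx | hx
  · rw [← hx]; simp
  have hc : (0 : ℝ) < classCard S x := by exact_mod_cast classCard_pos S x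
  have hNx : (classCard S x : ℝ) ≤ N * classCard S' x := by exact_mod_cast hN x
  have hNpos : (0 : ℝ) < N := by
    by_contra hneg
    have : (N : ℝ) = 0 := le_antisymm (not_lt.1 hneg) (Nat.cast_nonneg _)
    rw [this, zero_mul] at hNx
    linarith
  -- The `S'` class of `x` fills at least a fraction 1/N of its `S` class, and `q` is constant on
  -- it. Taking -log₂ turns the factor N into the additive log₂ N.
  have hmix : q x / N ≤ classAverage S q x := by
    have hsum : classCard S' x * q x ≤ ∑ y, if S x y then q y else 0 := by
      calc (classCard S' x : ℝ) * q x = ∑ y ∈ Finset.univ.filter fun y => S' x y, q y := by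
            rw [Finset.sum_congr rfl fun y hy => (hq x y (by simpa using hy)).symm]
            simp [classCard]
        _ ≤ ∑ y ∈ Finset.univ.filter fun y => S x y, q y :=
            Finset.sum_le_sum_of_subset_of_nonneg
              (fun y hy => by
                simp only [Finset.mem_filter, Finset.mem_univ, true_and] at hy ⊢
                exact hS hy)
              fun y _ _ => h0 y
        _ = _ := by rw [Finset.sum_filter]
    unfold classAverage
    rw [div_le_div_iff₀ hNpos hc]
    nlinarith [mul_le_mul_of_nonneg_right hNx hx.le, mul_le_mul_of_nonneg_left hsum hNpos.le]
  rw [entropyTerm_eq hx.le, mul_comm (ENNReal.ofReal (Real.log N / _)), ← mul_add]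
  refine mul_le_mul_right ?_ _
  refine (infoBits_anti (div_pos hx hNpos) hmix).trans ?_
  unfold infoBits
  rw [Real.log_div hx.ne' hNpos.ne']
  refine le_trans (le_of_eq ?_) ENNReal.ofReal_add_le
  congr 1
  ring

end Average

/-! ### Privacy bounds the information that a player receives -/

section PrivateTranscript

variable {κ X α : Type*} [Fintype κ] [DecidableEq κ] [Fintype X] {Ω : κ → Type*}
  [∀ i, MeasurableSpace (Ω i)]

/-- The number of bits of information on `x` in `Z x r` given its class in `S`, summed over `x`,
for a fixed value `r` of the randomness. -/
noncomputable def conditionalBits (S : Setoid X) (z : X → α) : ℝ≥0∞ :=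
  ∑ x, ENNReal.ofReal ((Real.log (classCard S x) - Real.log (classCard (S ⊓ Setoid.ker z) x)) /
    Real.log 2)

open Classical in
-- For deterministic `z`, the only randomness is a uniform point of the class: the value `z x` has
-- probability equal to the ratio of the two class sizes. The left side is the form to which Jensen
-- applies.
lemma tsum_sum_entropyTerm_indicator (S : Setoid X) (z : X → α) :
    ∑' a, ∑ x, entropyTerm (classAverage S (fun y => if z y = a then 1 else 0) x) =
      conditionalBits S z := by
  have h0 : ∀ a y, (0 : ℝ) ≤ if z y = a then 1 else 0 := fun a y => by split_ifs <;> norm_num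
  simp_rw [sum_entropyTerm_classAverage S (h0 _)]
  rw [Summable.tsum_finsetSum fun _ _ => ENNReal.summable]
  refine Finset.sum_congr rfl fun x _ => ?_
  rw [tsum_eq_single (z x) fun a ha => by simp [ha.symm]]
  rw [if_pos rfl, ENNReal.ofReal_one, one_mul, infoBits]
  congr 2
  have : (∑ y, if S x y then (if z y = z x then (1 : ℝ) else 0) else 0) =
      classCard (S ⊓ Setoid.ker z) x := by
    unfold classCard
    rw [Finset.card_filter, Nat.cast_sum]
    refine Finset.sum_congr rfl fun y _ => ?_
    simp only [Setoid.inf_def, Pi.inf_apply, Setoid.ker_def, inf_Prop_eq]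
    by_cases h1 : S x y <;> by_cases h2 : z x = z y <;> simp [h1, h2, eq_comm]
  rw [classAverage, this, Real.log_div]
  · ring
  · exact_mod_cast (classCard_pos _ x).ne'
  · exact_mod_cast (classCard_pos _ x).ne'

lemma measurable_classAverage {Ω' : Type*} [MeasurableSpace Ω'] (S : Setoid X) {q : Ω' → X → ℝ}
    (hq : ∀ x, Measurable fun ω => q ω x) (x : X) :
    Measurable fun ω => classAverage S (q ω) x := by
  unfold classAverage
  refine (Finset.measurable_sum _ fun y _ => ?_).div_const _
  split_ifs
  exacts [hq y, measurable_const]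

lemma integral_classAverage {Ω' : Type*} [MeasurableSpace Ω'] (μ : Measure Ω') (S : Setoid X)
    {q : Ω' → X → ℝ} (hq : ∀ x, Integrable (fun ω => q ω x) μ) (x : X) :
    ∫ ω, classAverage S (q ω) x ∂μ = classAverage S (fun y => ∫ ω, q ω y ∂μ) x := by
  unfold classAverage
  rw [integral_div, integral_finsetSum]
  · congr 1
    refine Finset.sum_congr rfl fun y _ => ?_
    split_ifs <;> simp
  · intro y _
    split_ifs
    exacts [hq y, integrable_zero _ _ _]

lemma measurable_conditionalBits [Countable α] {Ω' : Type*} [MeasurableSpace Ω'] (S : Setoid X)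
    {Z : X → Ω' → α} (hZ : ∀ x a, MeasurableSet {r | Z x r = a}) :
    Measurable fun r => conditionalBits S fun x => Z x r := by
  classical
  simp_rw [← tsum_sum_entropyTerm_indicator]
  exact Measurable.tsum fun a => Finset.measurable_sum _ fun x _ =>
    measurable_entropyTerm.comp (measurable_classAverage S
      (fun y => Measurable.ite (hZ y a) measurable_const measurable_const) x)

/-- The information that a player gets in an execution with fixed randomness is bounded by the
entropy of its transcript and the information in its output, if its transcript is private. -/
lemma lintegral_conditionalBits_le [Countable α] (P : ∀ i, Measure (Ω i))
    [∀ i, IsProbabilityMeasure (P i)] (i : κ) (Z : X → (∀ i, Ω i) → α)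
    (hZ : ∀ x a, MeasurableSet {r | Z x r = a}) {S S' : Setoid X} (hS : S' ≤ S) {N : ℕ}
    (hN : ∀ x, classCard S x ≤ N * classCard S' x)
    (hpriv : ∀ ρ x y, S' x y → ∀ a, Measure.pi P {r | Z x (Function.update r i ρ) = a} =
      Measure.pi P {r | Z y (Function.update r i ρ) = a}) :
    ∫⁻ r, conditionalBits S (fun x => Z x r) ∂(Measure.pi P) ≤
      ∑ x, entropy (Measure.pi P) (Z x) +
        Fintype.card X * ENNReal.ofReal (Real.log N / Real.log 2) := by
  classical
  have hmp := measurePreserving_update P i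
  set μ := Measure.pi P with hμ
  have : IsProbabilityMeasure μ := by rw [hμ]; infer_instance
  have hup : ∀ ρ, Measurable fun r : ∀ j, Ω j => Function.update r i ρ := fun ρ =>
    hmp.measurable.comp measurable_prodMk_left
  -- `q ρ` gives the law of `Z x` once the tape of player `i` is `ρ`; `F r` gives the law over the
  -- class of `x` when all tapes are fixed.
  let q : Ω i → α → X → ℝ := fun ρ a x => μ.real {r | Z x (Function.update r i ρ) = a}
  let F : (∀ j, Ω j) → α → X → ℝ := fun r a =>
    classAverage S (fun y => if Z y r = a then 1 else 0)
  have hind0 : ∀ r a y, (0 : ℝ) ≤ if Z y r = a then 1 else 0 :=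
    fun r a y => by split_ifs <;> norm_num
  have hind1 : ∀ r a y, (if Z y r = a then 1 else 0) ≤ (1 : ℝ) :=
    fun r a y => by split_ifs <;> norm_num
  have hindm : ∀ a y, Measurable fun r => if Z y r = a then (1 : ℝ) else 0 := fun a y =>
    Measurable.ite (hZ y a) measurable_const measurable_const
  have hFm : ∀ a x, Measurable fun r => F r a x := fun a x =>
    measurable_classAverage S (hindm a) x
  have hGm : Measurable fun r => conditionalBits S fun x => Z x r :=
    measurable_conditionalBits S hZ
  -- averaging over the tapes of the other players
  have hC : ∀ ρ a x, ∫⁻ r, entropyTerm (F (Function.update r i ρ) a x) ∂μ ≤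
      entropyTerm (classAverage S (q ρ a) x) := by
    intro ρ a x
    refine (lintegral_entropyTerm_le μ ((hFm a x).comp (hup ρ))
      (fun r => classAverage_nonneg S (hind0 _ a) x)
      (fun r => classAverage_le_one S (hind1 _ a) x)).trans_eq ?_
    congr 1
    have hint : ∀ y, Integrable (fun r =>
        if Z y (Function.update r i ρ) = a then (1 : ℝ) else 0) μ :=
      fun y => Integrable.of_bound ((hindm a y).comp (hup ρ)).aestronglyMeasurable 1
        (Filter.Eventually.of_forall fun r => by
          rw [Real.norm_eq_abs, abs_of_nonneg (hind0 _ a y)]; exact hind1 _ a y)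
    refine (integral_classAverage μ S hint x).trans ?_
    congr 1
    ext y
    have hms : MeasurableSet {r | Z y (Function.update r i ρ) = a} := hup ρ (hZ y a)
    rw [show q ρ a y = μ.real {r | Z y (Function.update r i ρ) = a} from rfl,
      ← integral_indicator_one hms]
    rfl
  -- averaging over the tape of player `i`
  have hA : ∀ a x, ∫⁻ ρ, entropyTerm (q ρ a x) ∂(P i) ≤ entropyTerm (μ.real (Z x ⁻¹' {a})) := by
    intro a x
    have hms : MeasurableSet {ω : Ω i × (∀ j, Ω j) | Z x (Function.update ω.2 i ω.1) = a} :=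
      hmp.measurable (hZ x a)
    have hqm : Measurable fun ρ => μ {r | Z x (Function.update r i ρ) = a} :=
      measurable_measure_prodMk_left hms
    refine (lintegral_entropyTerm_le (P i) hqm.ennreal_toReal (fun ρ => measureReal_nonneg)
      (fun ρ => measureReal_le_one)).trans_eq ?_
    congr 1
    rw [integral_toReal hqm.aemeasurable (Filter.Eventually.of_forall fun ρ => measure_lt_top _ _),
      measureReal_def, show μ (Z x ⁻¹' {a}) =
        ((P i).prod μ) {ω | Z x (Function.update ω.2 i ω.1) = a} from
          (hmp.measure_preimage (hZ x a).nullMeasurableSet).symm, Measure.prod_apply hms]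
    rfl
  have hsum1 : ∀ ρ x, ∑' a, ENNReal.ofReal (q ρ a x) = 1 := by
    intro ρ x
    have hms : ∀ a, MeasurableSet {r | Z x (Function.update r i ρ) = a} := fun a => hup ρ (hZ x a)
    simp_rw [q, ofReal_measureReal (measure_ne_top μ _)]
    rw [← measure_iUnion _ hms]
    · rw [← measure_univ (μ := μ)]
      congr 1
      ext r
      simp
    · intro a b hab
      refine Set.disjoint_left.2 fun r ha hb => hab ?_
      exact Eq.trans (Eq.symm ha) hb
  have hqm : ∀ a x, Measurable fun ρ => entropyTerm (q ρ a x) := fun a x => by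
    have hms : MeasurableSet {ω : Ω i × (∀ j, Ω j) | Z x (Function.update ω.2 i ω.1) = a} :=
      hmp.measurable (hZ x a)
    exact measurable_entropyTerm.comp (measurable_measure_prodMk_left hms).ennreal_toReal
  calc ∫⁻ r, conditionalBits S (fun x => Z x r) ∂μ
      = ∫⁻ ω, conditionalBits S (fun x => Z x (Function.update ω.2 i ω.1)) ∂((P i).prod μ) :=
        (hmp.lintegral_comp hGm).symm
    _ = ∫⁻ ρ, ∫⁻ r, conditionalBits S (fun x => Z x (Function.update r i ρ)) ∂μ ∂(P i) :=
        lintegral_prod _ (hGm.comp hmp.measurable).aemeasurable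
    _ = ∫⁻ ρ, ∑' a, ∑ x, ∫⁻ r, entropyTerm (F (Function.update r i ρ) a x) ∂μ ∂(P i) := by
        refine lintegral_congr fun ρ => ?_
        have hm : ∀ a x, Measurable fun r => entropyTerm (F (Function.update r i ρ) a x) :=
          fun a x => measurable_entropyTerm.comp ((hFm a x).comp (hup ρ))
        simp_rw [← lintegral_finsetSum _ fun x _ => hm _ x]
        rw [← lintegral_tsum fun a => (Finset.measurable_sum _ fun x _ => hm a x).aemeasurable]
        simp_rw [← tsum_sum_entropyTerm_indicator]
        rfl
    -- Jensen over the other tapes leads to the class averages of `q ρ`. By privacy `q ρ` is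
    -- constant on `S'` classes, so undoing the average costs log₂ N per input, each law having
    -- total mass 1.
    _ ≤ ∫⁻ ρ, (∑' a, ∑ x, entropyTerm (q ρ a x)) +
          Fintype.card X * ENNReal.ofReal (Real.log N / Real.log 2) ∂(P i) := by
        refine lintegral_mono fun ρ => ?_
        calc ∑' a, ∑ x, ∫⁻ r, entropyTerm (F (Function.update r i ρ) a x) ∂μ
            ≤ ∑' a, ∑ x, (entropyTerm (q ρ a x) + ENNReal.ofReal (Real.log N / Real.log 2) *
                ENNReal.ofReal (q ρ a x)) :=
              ENNReal.tsum_le_tsum fun a => (Finset.sum_le_sum fun x _ => hC ρ a x).trans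
                (sum_entropyTerm_classAverage_le hS hN (fun x => measureReal_nonneg)
                  fun x y hxy => congrArg ENNReal.toReal (hpriv ρ x y hxy a))
          _ = _ := by
              simp_rw [Finset.sum_add_distrib, ← Finset.mul_sum]
              rw [ENNReal.tsum_add, ENNReal.tsum_mul_left,
                Summable.tsum_finsetSum (f := fun x a => ENNReal.ofReal (q ρ a x))
                  fun _ _ => ENNReal.summable]
              simp_rw [hsum1]
              simp [mul_comm]
    _ = (∑' a, ∑ x, ∫⁻ ρ, entropyTerm (q ρ a x) ∂(P i)) +
          Fintype.card X * ENNReal.ofReal (Real.log N / Real.log 2) := by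
        rw [lintegral_add_right _ measurable_const, lintegral_const, measure_univ, mul_one,
          lintegral_tsum fun a => (Finset.measurable_sum _ fun x _ => hqm a x).aemeasurable]
        simp_rw [lintegral_finsetSum _ fun x _ => hqm _ x]
    _ ≤ _ := by
        refine add_le_add_left ?_ _
        simp_rw [entropy_eq_tsum]
        rw [← Summable.tsum_finsetSum (f := fun x a => entropyTerm (μ.real (Z x ⁻¹' {a})))
          fun _ _ => ENNReal.summable]
        exact ENNReal.tsum_le_tsum fun a => Finset.sum_le_sum fun x _ => hA a x

end PrivateTranscript

/-! ### Measurability of transcripts -/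

section DiscreteMeasurable

variable {Ω α β γ ι : Type*} [MeasurableSpace Ω]

/-- A random variable whose level sets are measurable. -/
def LevelMeasurable (f : Ω → α) : Prop := ∀ a, MeasurableSet {ω | f ω = a}

/-- Countably many values allow freezing the first variable, which replaces measurability on types
of lists and histories that carry no σ-algebra here. -/
lemma LevelMeasurable.bind [Countable α] {f : Ω → α} (hf : LevelMeasurable f) {F : α → Ω → β}
    (hF : ∀ a, LevelMeasurable (F a)) : LevelMeasurable fun ω => F (f ω) ω := by
  intro b
  have : {ω | F (f ω) ω = b} = ⋃ a, {ω | f ω = a} ∩ {ω | F a ω = b} := by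
    ext ω
    simp
  rw [this]
  exact MeasurableSet.iUnion fun a => (hf a).inter (hF a b)

lemma levelMeasurable_const (b : β) : LevelMeasurable fun _ : Ω => b := fun _ =>
  MeasurableSet.const _

lemma LevelMeasurable.map [Countable α] {f : Ω → α} (hf : LevelMeasurable f) (g : α → β) :
    LevelMeasurable fun ω => g (f ω) :=
  hf.bind (F := fun a _ => g a) fun a => levelMeasurable_const (g a)

lemma LevelMeasurable.pi [Finite ι] {X : ι → Type*} {f : ∀ i, Ω → X i}
    (hf : ∀ i, LevelMeasurable (f i)) : LevelMeasurable fun ω i => f i ω := by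
  intro a
  have : {ω | (fun i => f i ω) = a} = ⋂ i, {ω | f i ω = a i} := by
    ext ω
    simp [funext_iff]
  rw [this]
  exact MeasurableSet.iInter fun i => hf i (a i)

lemma LevelMeasurable.filterMap [Countable β] (l : List ι) {u : ι → Ω → Option β}
    (hu : ∀ t, LevelMeasurable (u t)) :
    LevelMeasurable fun ω => l.filterMap fun t => u t ω := by
  induction l with
  | nil => exact levelMeasurable_const _
  | cons t l ih =>
    have := (hu t).bind (F := fun o ω => o.toList ++ l.filterMap fun t => u t ω)
      fun o => ih.map fun l' => o.toList ++ l'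
    convert this using 2 with ω
    cases h : u t ω <;> simp [h]

end DiscreteMeasurable

namespace Protocol

variable {k : ℕ} {X Y Ω : Fin k → Type*} {Ωp : Type*} {π : Protocol k X Y Ω Ωp}
  [∀ i, MeasurableSpace (Ω i)] [MeasurableSpace Ωp]

lemma levelMeasurable_sentGiven (hm : π.MeasurableActions) (x : ∀ i, X i) (i q : Fin k)
    (h : List (RoundReads k)) :
    LevelMeasurable fun ω : (∀ i, Ω i) × Ωp => π.sentGiven x ω.1 ω.2 i h q := by
  have hp : Measurable fun ω : (∀ i, Ω i) × Ωp => (ω.1 i, ω.2) :=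
    ((measurable_pi_apply i).comp measurable_fst).prodMk measurable_snd
  refine LevelMeasurable.filterMap _ fun t => ?_
  have h1 : LevelMeasurable fun ω : (∀ i, Ω i) × Ωp =>
      π.sendTo i (t + 1) (viewAt x ω.1 ω.2 i (h.take t)) := fun s =>
    hp ((hm i (t + 1) (x i) (h.take t)).1 s)
  have h2 : LevelMeasurable fun ω : (∀ i, Ω i) × Ωp =>
      π.msg i (t + 1) (viewAt x ω.1 ω.2 i (h.take t)) q := fun s =>
    hp ((hm i (t + 1) (x i) (h.take t)).2.1 q s)
  exact h1.bind (F := fun s ω => if q ∈ s then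
    some (π.msg i (t + 1) (viewAt x ω.1 ω.2 i (h.take t)) q) else none) fun s =>
      h2.map fun m => if q ∈ s then some m else none

/-- With the current histories frozen, one time step depends only on finitely many actions at fixed
views, and those are measurable by assumption. -/
lemma levelMeasurable_history (hm : π.MeasurableActions) (x : ∀ i, X i) (T : ℕ) :
    LevelMeasurable fun ω : (∀ i, Ω i) × Ωp => π.history x ω.1 ω.2 T := by
  induction T with
  | zero => exact levelMeasurable_const _
  | succ T ih =>
    refine ih.bind (F := fun h ω i =>
      if ∀ q ∈ π.waitFor i ((h i).length + 1) (viewAt x ω.1 ω.2 i (h i)),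
          numRead (h i) q < (π.sentGiven x ω.1 ω.2 q (h q) i).length then
        h i ++ [fun q => if q ∈ π.waitFor i ((h i).length + 1) (viewAt x ω.1 ω.2 i (h i)) then
          (π.sentGiven x ω.1 ω.2 q (h q) i)[numRead (h i) q]? else none]
      else h i) fun h => LevelMeasurable.pi fun i => ?_
    have hp : Measurable fun ω : (∀ i, Ω i) × Ωp => (ω.1 i, ω.2) :=
      ((measurable_pi_apply i).comp measurable_fst).prodMk measurable_snd
    have h1 : LevelMeasurable fun ω : (∀ i, Ω i) × Ωp =>
        π.waitFor i ((h i).length + 1) (viewAt x ω.1 ω.2 i (h i)) := fun s =>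
      hp ((hm i ((h i).length + 1) (x i) (h i)).2.2.2 s)
    have h2 : LevelMeasurable fun (ω : (∀ i, Ω i) × Ωp) q => π.sentGiven x ω.1 ω.2 q (h q) i :=
      LevelMeasurable.pi fun q => levelMeasurable_sentGiven hm x q i (h q)
    exact h1.bind (F := fun W ω =>
      if ∀ q ∈ W, numRead (h i) q < (π.sentGiven x ω.1 ω.2 q (h q) i).length then
        h i ++ [fun q => if q ∈ W then
          (π.sentGiven x ω.1 ω.2 q (h q) i)[numRead (h i) q]? else none]
      else h i) fun W => h2.map fun s =>
        if ∀ q ∈ W, numRead (h i) q < (s q).length then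
          h i ++ [fun q => if q ∈ W then (s q)[numRead (h i) q]? else none]
        else h i

lemma levelMeasurable_playerTranscript (hm : π.MeasurableActions) {T₀ : ℕ}
    (h₀ : ∀ (x : ∀ i, X i) (r : ∀ i, Ω i) (rp : Ωp), ∀ T ≥ T₀, ∀ i q,
      π.readAt x r rp T i q = none) (x : ∀ i, X i) (i : Fin k) :
    LevelMeasurable fun ω : (∀ i, Ω i) × Ωp => π.playerTranscript x ω.1 ω.2 i := by
  simp_rw [fun ω : (∀ i, Ω i) × Ωp =>
    playerTranscript_eq fun T hT q => h₀ x ω.1 ω.2 T hT i q]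
  exact (levelMeasurable_history hm x T₀).map fun h => (h i).flatMap fun reads =>
    (List.finRange k).flatMap fun q => (reads q).getD []

lemma levelMeasurable_transcript (hm : π.MeasurableActions) {T₀ : ℕ}
    (h₀ : ∀ (x : ∀ i, X i) (r : ∀ i, Ω i) (rp : Ωp), ∀ T ≥ T₀, ∀ i q,
      π.readAt x r rp T i q = none) (x : ∀ i, X i) :
    LevelMeasurable fun ω : (∀ i, Ω i) × Ωp => π.transcript x ω.1 ω.2 :=
  (LevelMeasurable.pi fun i => levelMeasurable_playerTranscript hm h₀ x i).map fun s =>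
    (List.finRange k).flatMap s

lemma measurable_entropy_transcript (P : ∀ i, Measure (Ω i)) [∀ i, IsProbabilityMeasure (P i)]
    (hm : π.MeasurableActions) {T₀ : ℕ}
    (h₀ : ∀ (x : ∀ i, X i) (r : ∀ i, Ω i) (rp : Ωp), ∀ T ≥ T₀, ∀ i q,
      π.readAt x r rp T i q = none) (x : ∀ i, X i) :
    Measurable fun rp => entropy (Measure.pi P) fun r => π.transcript x r rp := by
  simp_rw [entropy_eq_tsum]
  refine Measurable.tsum fun s => measurable_entropyTerm.comp (Measurable.ennreal_toReal ?_)
  exact measurable_measure_prodMk_right (levelMeasurable_transcript hm h₀ x s)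

end Protocol

/-! ### Combining the two bounds and averaging over the public tape -/

lemma ofReal_logClassSum_le_conditionalBits {X U α : Type*} [Fintype X] (g : X → U) (z : X → α) :
    ENNReal.ofReal ((logClassSum (Setoid.ker g) - logClassSum (Setoid.ker fun x => (g x, z x))) /
      Real.log 2) ≤ conditionalBits (Setoid.ker g) z := by
  have : Setoid.ker (fun x => (g x, z x)) = Setoid.ker g ⊓ Setoid.ker z := by
    ext x y
    simp [Setoid.ker_def, Setoid.inf_def]
  rw [this, logClassSum, logClassSum, ← Finset.sum_sub_distrib, Finset.sum_div]
  exact Finset.le_sum_of_subadditive _ ENNReal.ofReal_zero.le (fun _ _ => ENNReal.ofReal_add_le) _ _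

/-- The bound for a fixed value of the public randomness. -/
lemma Protocol.le_sum_entropy_transcript {k n : ℕ} (hk : 2 ≤ k) (a : Fin n → Fin k)
    {Ω : Fin k → Type*} {Ωp : Type*} [∀ i, MeasurableSpace (Ω i)]
    [MeasurableSpace Ωp] (P : ∀ i, Measure (Ω i)) [∀ i, IsProbabilityMeasure (P i)]
    {π : Protocol k (fun _ => Fin n → Bool) (fun i => {p : Fin n // a p = i} → Bool) Ω Ωp}
    (hwf : π.WellFormed) (hobl : π.Oblivious) (hpriv : π.IsPrivate P (parity a)) {T₀ : ℕ}
    (h₀ : ∀ x r rp, ∀ T ≥ T₀, ∀ i q, π.readAt x r rp T i q = none) (rp : Ωp)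
    (hcorr : ∀ᵐ r ∂(Measure.pi P), ∀ x i, ∃ j, π.Writes x r rp i j (parity a i x)) :
    ENNReal.ofReal ((Fintype.card (Fin k → Fin n → Bool) : ℝ) * (((k : ℝ) - 1) * n)) ≤
      k * ∑ x, entropy (Measure.pi P) (fun r => π.transcript x r rp) +
        Fintype.card (Fin k → Fin n → Bool) * n := by
  have hZ : ∀ i x s, MeasurableSet {r | π.playerTranscript x r rp i = s} := fun i x s =>
    measurable_prodMk_right (levelMeasurable_playerTranscript hwf.measurableActions h₀ x i s)
  have hlog : 0 < Real.log 2 := Real.log_pos one_lt_two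
  let D : Fin k → (∀ i, Ω i) → ℝ≥0∞ := fun i r => conditionalBits
    (Setoid.ker fun x : Fin k → Fin n → Bool => x i) fun x => π.playerTranscript x r rp i
  have hupper : ∀ i, ∫⁻ r, D i r ∂(Measure.pi P) ≤
      ∑ x, entropy (Measure.pi P) (fun r => π.transcript x r rp) +
        Fintype.card (Fin k → Fin n → Bool) * (Fintype.card {p // a p = i} : ℝ≥0∞) := by
    intro i
    refine (lintegral_conditionalBits_le P i (fun x r => π.playerTranscript x r rp i) (hZ i)
      (S' := Setoid.ker fun x : Fin k → Fin n → Bool => (x i, parity a i x))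
      (fun x y h => (Prod.mk.inj h).1) (card_ker_le_mul_card_ker_parity hk a i)
      (fun ρ x y h s => hpriv i x y (Prod.mk.inj h).2 (Prod.mk.inj h).1 ρ rp s)).trans ?_
    refine add_le_add (Finset.sum_le_sum fun x _ => ?_) (le_of_eq ?_)
    · exact entropy_le_of_determined _ _ _ fun r r' h =>
        playerTranscript_eq_of_transcript_eq hobl hwf.selfDelimiting h₀ h i
    · rw [Nat.cast_pow, Nat.cast_ofNat, Real.log_pow, mul_div_cancel_right₀ _ hlog.ne',
        ENNReal.ofReal_natCast]
  -- The factor log 2 converts natural logarithms to bits; all sums over inputs are unnormalised,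
  -- hence the factor counting the inputs.
  have hlower : ∀ᵐ r ∂(Measure.pi P), ENNReal.ofReal
      ((Fintype.card (Fin k → Fin n → Bool) : ℝ) * (((k : ℝ) - 1) * n)) ≤ ∑ i, D i r := by
    filter_upwards [hcorr] with r hr
    refine le_trans ?_ (Finset.sum_le_sum fun i _ => ofReal_logClassSum_le_conditionalBits _ _)
    refine le_trans ?_ (Finset.le_sum_of_subadditive _ ENNReal.ofReal_zero.le
      (fun _ _ => ENNReal.ofReal_add_le) _ _)
    refine ENNReal.ofReal_le_ofReal ?_
    rw [← Finset.sum_div, le_div_iff₀ hlog]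
    refine le_trans (le_of_eq ?_) (le_sum_logClassSum_playerTranscript a hobl hwf.selfDelimiting
      hwf.writesAtMostOnce h₀ r rp hr)
    ring
  calc _ = ∫⁻ _, ENNReal.ofReal
        ((Fintype.card (Fin k → Fin n → Bool) : ℝ) * (((k : ℝ) - 1) * n)) ∂(Measure.pi P) := by
        simp
    _ ≤ ∫⁻ r, ∑ i, D i r ∂(Measure.pi P) := lintegral_mono_ae hlower
    _ = ∑ i, ∫⁻ r, D i r ∂(Measure.pi P) :=
        lintegral_finsetSum _ fun i _ => measurable_conditionalBits _ (hZ i)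
    _ ≤ ∑ i, (∑ x, entropy (Measure.pi P) (fun r => π.transcript x r rp) +
        Fintype.card (Fin k → Fin n → Bool) * (Fintype.card {p // a p = i} : ℝ≥0∞)) :=
        Finset.sum_le_sum fun i _ => hupper i
    _ = _ := by
        rw [Finset.sum_add_distrib, Finset.sum_const, nsmul_eq_mul, Finset.card_univ,
          Fintype.card_fin, ← Finset.mul_sum, ← Nat.cast_sum, ← Fintype.card_sigma,
          Fintype.card_congr (Equiv.sigmaFiberEquiv a), Fintype.card_fin]

/-- Here `E` stands for the entropies summed over the `N` inputs: (k-1)n ≤ k·E/N + n rearranges to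
the claimed bound, and E = ∞ is trivial. -/
lemma ofReal_le_inv_mul_of_le {k n N : ℕ} (hk : 2 ≤ k) (hN : 0 < N) {E : ℝ≥0∞}
    (h : ENNReal.ofReal ((N : ℝ) * (((k : ℝ) - 1) * n)) ≤ k * E + N * n) :
    ENNReal.ofReal (((k : ℝ) - 2) / k * n) ≤ (N : ℝ≥0∞)⁻¹ * E := by
  have hN' : (0 : ℝ) < N := by exact_mod_cast hN
  have hk' : (0 : ℝ) < k := by exact_mod_cast (by omega : 0 < k)
  rcases eq_or_ne E ⊤ with rfl | hE
  · rw [ENNReal.mul_top (ENNReal.inv_ne_zero.2 (ENNReal.natCast_ne_top N))]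
    exact le_top
  lift E to NNReal using hE
  have h' : (N : ℝ) * (((k : ℝ) - 1) * n) ≤ k * E + N * n := by
    have e : (k : ℝ≥0∞) * E + N * n = ENNReal.ofReal (k * E + N * n) := by
      rw [ENNReal.ofReal_add (by positivity) (by positivity), ENNReal.ofReal_mul (by positivity),
        ENNReal.ofReal_mul (by positivity)]
      simp
    rw [e] at h
    exact (ENNReal.ofReal_le_ofReal_iff (by positivity)).1 h
  have e : (N : ℝ≥0∞)⁻¹ * E = ENNReal.ofReal ((N : ℝ)⁻¹ * E) := by
    rw [ENNReal.ofReal_mul (by positivity), ENNReal.ofReal_inv_of_pos hN']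
    simp
  rw [e]
  refine ENNReal.ofReal_le_ofReal ?_
  rw [inv_mul_eq_div, div_mul_eq_mul_div, div_le_div_iff₀ hk' hN']
  linarith

theorem mainTheorem2 {k n : ℕ} (a : Fin n → Fin k)
    {Ω : Fin k → Type*} {Ωp : Type*} [∀ i, MeasurableSpace (Ω i)] [MeasurableSpace Ωp]
    (P : ∀ i, Measure (Ω i)) [∀ i, IsProbabilityMeasure (P i)]
    (Pp : Measure Ωp) [IsProbabilityMeasure Pp]
    (π : Protocol k (fun _ => Fin n → Bool) (fun i => {p : Fin n // a p = i} → Bool) Ω Ωp)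
    (hwf : π.WellFormed) (hobl : π.Oblivious)
    (hcomp : π.Computes P Pp (parity a) 0)
    (hpriv : π.IsPrivate P (parity a)) :
    ENNReal.ofReal (((k : ℝ) - 2) / k * n) ≤
      π.transcriptEntropy P Pp (PMF.uniformOfFintype (Fin k → Fin n → Bool)) := by
  -- For k < 2 the bound is not positive, and `ENNReal.ofReal` sends it to 0.
  rcases lt_or_ge k 2 with hk | hk
  · rw [ENNReal.ofReal_of_nonpos]
    · exact zero_le
    · refine mul_nonpos_of_nonpos_of_nonneg (div_nonpos_of_nonpos_of_nonneg ?_ (Nat.cast_nonneg _))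
        (Nat.cast_nonneg _)
      have : (k : ℝ) ≤ 2 := by exact_mod_cast hk.le
      linarith
  have : ∀ i, Nonempty (Ω i) := fun i => nonempty_of_isProbabilityMeasure (P i)
  have : Nonempty Ωp := nonempty_of_isProbabilityMeasure Pp
  obtain ⟨T₀, h₀⟩ := Protocol.exists_forall_readAt_eq_none hobl hwf.stops
  -- There are finitely many inputs, so zero error holds for all of them at once outside a null set
  -- of tapes; Fubini makes this a statement for almost every public tape.
  have hcorr : ∀ᵐ rp ∂Pp, ∀ᵐ r ∂(Measure.pi P), ∀ x i,
      ∃ j, π.Writes x r rp i j (parity a i x) := by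
    have h1 : ∀ᵐ ω ∂((Measure.pi P).prod Pp), ∀ x i,
        ∃ j, π.Writes x ω.1 ω.2 i j (parity a i x) :=
      ae_all_iff.2 fun x => nonpos_iff_eq_zero.1 (hcomp.2 x)
    exact Measure.ae_ae_of_ae_prod
      (Measure.measurePreserving_swap.quasiMeasurePreserving.ae h1)
  unfold Protocol.transcriptEntropy
  simp_rw [PMF.uniformOfFintype_apply]
  rw [tsum_fintype, ← Finset.mul_sum, ← lintegral_finsetSum _ fun x _ =>
    Protocol.measurable_entropy_transcript P hwf.measurableActions h₀ x,
    ← lintegral_const_mul _ (Finset.measurable_sum _ fun x _ =>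
      Protocol.measurable_entropy_transcript P hwf.measurableActions h₀ x)]
  calc _ = ∫⁻ _, ENNReal.ofReal (((k : ℝ) - 2) / k * n) ∂Pp := by simp
    _ ≤ _ := lintegral_mono_ae ?_
  filter_upwards [hcorr] with rp hrp
  exact ofReal_le_inv_mul_of_le hk Fintype.card_pos
    (Protocol.le_sum_entropy_transcript hk a P hwf hobl hpriv h₀ rp hrp)
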